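/- Let $n\ge 1$. All manifolds are (finite-dimensional) complex manifolds and all forms, maps and actions are holomorphic. An action of a complex Lie group $G$ on a symplectic manifold $(X,\omega)$ is Hamiltonian with moment map $\Phi:X\to\mathfrak g$ (where $\mathfrak g^*\simeq\mathfrak g$ by the trace form) if it preserves $\omega$, $\Phi$ is equivariant, and $\omega(X_\xi,\cdot)=d\,\mathrm{tr}(\Phi\,\xi)$ for all $\xi\in\mathfrak g$, where $X_\xi$ is the vector field generated by $\xi$. The symplectic quotient of $X$ by $G$ is $\Phi^{-1}(0)/G$, with the complex structure for which the projection from $\Phi^{-1}(0)$ is a holomorphic submersion, and with the symplectic form whose pull-back to $\Phi^{-1}(0)$ is the restriction of $\omega$. $B_{(m)}$ denotes the upper-left $m\times m$ block of a matrix $B$. For each $i$ let $T^*GL(i,\mathbb C)\simeq GL(i,\mathbb C)\times\mathfrak{gl}(i,\mathbb C)\ni(g,B)$ (trivialisation by right-invariant forms and the trace form) carry the symplectic form $$\omega\bigl((\rho,b),(\hat\rho,\hat b)\bigr)=\mathrm{tr}\bigl(\rho\hat b-\hat\rho b-B[\rho,\hat\rho]\bigr),$$ where $\rho,\hat\rho$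 denote right-invariant vector fields, with the left action $h\cdot(g,B)=(hg,hBh^{-1})$ and the right action $h\cdot(g,B)=(gh^{-1},B)$ of $GL(i,\mathbb C)$. Let $(M,\omega_M)$ be a symplectic manifold with a Hamiltonian action of $GL(n,\mathbb C)$ with moment map $\mu:M\to\mathfrak{gl}(n,\mathbb C)$. Let $H=\prod_{i=1}^n GL(i,\mathbb C)$ act on $X=M\times\prod_{i=1}^nT^*GL(i,\mathbb C)$ as follows: $GL(n,\mathbb C)$ acts in the given way on $M$ and on the right of $T^*GL(n,\mathbb C)$, and for $i<n$ the factor $GL(i,\mathbb C)$ acts on the right of $T^*GL(i,\mathbb C)$ and on the left of $T^*GL(i+1,\mathbb C)$ as the subgroup of upper-left $i\times i$ blocks. Then: 1. $X$ with the product form is symplectic, and the action of $H$ is Hamiltonian; its moment map at $(p,(g_j,B_j)_j)$ has the components $\mu(p)-g_n^{-1}B_ng_n$ and $(B_{j+1})_{(j)}-g_j^{-1}B_jg_j$, $j<n$. The symplectic quotient of $X$ by $H$ exists ($0$ is a regular value of the moment map), and $M$ is symplectomorphic to it by the map that sends $p$ to the class of $\bigl(p,(1,\mu(p)_{(m)})_{m=1}^n\bigr)$.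 2. For each $m$ let $C_m\simeq\mathbb C^m$ act on the factor $T^*GL(m,\mathbb C)$ of $X$ by the flows $z\cdot(g,B)=(e^{izB^{i-1}}g,B)$ of the Hamiltonian vector fields of the functions $\mathrm{tr}\,B^i$, $i=1,\dots,m$. These flows define an action of $\prod_{m=1}^nC_m\simeq\mathbb C^{n(n+1)/2}$ on $X$, which commutes with $H$, preserves the zero level set, and hence induces an action on the symplectic quotient. The action on $M$ that corresponds to it under the identification in 1 is holomorphic and Hamiltonian: the generator of the $i$-th factor of $C_m\simeq\mathbb C^m$ acts by the flow of the Hamiltonian vector field of $$\mu_{mi}(p)=\mathrm{tr}\bigl((\mu(p)_{(m)})^i\bigr),\qquad 1\le i\le m\le n,$$ and these functions are invariant under the action. -/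

import Mathlib

open scoped Manifold ContDiff

/-! Spaces of matrices carry the operator norm, and the topology and uniform structure of this norm
(rather than the entrywise ones, which are equal to them but not syntactically so). -/

attribute [local instance] Matrix.linftyOpNormedRing Matrix.linftyOpNormedAlgebra
attribute [-instance] instTopologicalSpaceMatrix Matrix.instUniformSpace Matrix.instCompleteSpace
  TopCat.of.chartedSpace

instance instCompleteSpaceMatrixNorm (n : ℕ) : CompleteSpace (Matrix (Fin n) (Fin n) ℂ) :=
  FiniteDimensional.complete ℂ _

/-! ### Holomorphic symplectic forms -/

section Symplectic

variable {E : Type*} [NormedAddCommGroup E] [NormedSpace ℂ E]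
  {H : Type*} [TopologicalSpace H]

/-- A field of complex bilinear forms on the tangent spaces of a complex manifold. -/
abbrev TwoForm (I : ModelWithCorners ℂ E H) (X : Type*) [TopologicalSpace X] [ChartedSpace H X] :=
  ∀ x : X, TangentSpace I x →ₗ[ℂ] TangentSpace I x →ₗ[ℂ] ℂ

variable {I : ModelWithCorners ℂ E H} {X : Type*} [TopologicalSpace X] [ChartedSpace H X]

/-- The expression of `σ` in the chart around `x₀`: its value at the point `y` of the model
vector space on the constant vectors `v`, `w`. -/
noncomputable def TwoForm.inChart (σ : TwoForm I X) (x₀ : X) (v w y : E) : ℂ :=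
  σ ((extChartAt I x₀).symm y)
    (mfderiv 𝓘(ℂ, E) I (extChartAt I x₀).symm y v)
    (mfderiv 𝓘(ℂ, E) I (extChartAt I x₀).symm y w)

/-- A holomorphic symplectic form: a holomorphic, alternating, closed and nondegenerate
2-form. -/
structure IsSymplecticForm (σ : TwoForm I X) : Prop where
  holomorphic : ∀ (x₀ : X) (v w : E),
    ContDiffOn ℂ ω (σ.inChart x₀ v w) (extChartAt I x₀).target
  alternating : ∀ (x : X) (v : TangentSpace I x), σ x v v = 0
  closed : ∀ (x₀ : X) (u v w : E), ∀ y ∈ (extChartAt I x₀).target,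
    fderiv ℂ (σ.inChart x₀ v w) y u + fderiv ℂ (σ.inChart x₀ w u) y v
      + fderiv ℂ (σ.inChart x₀ u v) y w = 0
  nondegenerate : ∀ (x : X) (v : TangentSpace I x), (∀ w, σ x v w = 0) → v = 0

end Symplectic

/-! ### Hamiltonian actions and symplectic quotients -/

section Hamiltonian

variable {E : Type*} [NormedAddCommGroup E] [NormedSpace ℂ E]
  {H : Type*} [TopologicalSpace H] {I : ModelWithCorners ℂ E H}
  {X : Type*} [TopologicalSpace X] [ChartedSpace H X]

/-- `act` is a holomorphic Hamiltonian action, on `X` with the symplectic form `σ`, of the complex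
Lie group `Aˣ` of units of an algebra `A`, with moment map `Φ`. The Lie algebra of `Aˣ` is `A`, and
its dual is identified with `A` by means of the trace form `(a, b) ↦ τ (a * b)`. The sign convention
is `ι_ξ σ = d⟨Φ, ξ⟩`. -/
structure IsHamiltonianAction {A : Type*} [NormedRing A] [NormedAlgebra ℂ A] [CompleteSpace A]
    (τ : A →ₗ[ℂ] ℂ) (σ : TwoForm I X) (act : Aˣ → X → X) (Φ : X → A) : Prop where
  one_act : ∀ x, act 1 x = x
  mul_act : ∀ g h x, act (g * h) x = act g (act h x)
  holomorphic_act : ContMDiff (𝓘(ℂ, A).prod I) I ω (fun q : Aˣ × X => act q.1 q.2)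
  symplectic : ∀ (g : Aˣ) (x : X) (v w : TangentSpace I x),
    σ (act g x) (mfderiv I I (act g) x v) (mfderiv I I (act g) x w) = σ x v w
  holomorphic_moment : ContMDiff I 𝓘(ℂ, A) ω Φ
  moment : ∀ (x : X) (ξ : A) (v : TangentSpace I x),
    σ x (mfderiv 𝓘(ℂ, A) I (fun g : Aˣ => act g x) 1 ξ) v
      = mfderiv I 𝓘(ℂ, ℂ) (fun y => τ (Φ y * ξ)) x v
  equivariant : ∀ (g : Aˣ) (x : X), Φ (act g x) = g * Φ x * (g⁻¹ : Aˣ)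

/-- `θ` is a holomorphic action on `X` of the vector group `ℂ^ι`, whose `j`-th factor is the flow of
the Hamiltonian vector field of the holomorphic function `f j`, each `f j` being invariant. -/
structure IsHamiltonianVectorAction {ι : Type*} [Fintype ι] [DecidableEq ι]
    (σ : TwoForm I X) (θ : (ι → ℂ) → X → X) (f : ι → X → ℂ) : Prop where
  zero_act : ∀ x, θ 0 x = x
  add_act : ∀ s t x, θ (s + t) x = θ s (θ t x)
  holomorphic_act : ContMDiff (𝓘(ℂ, ι → ℂ).prod I) I ω (fun q : (ι → ℂ) × X => θ q.1 q.2)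
  holomorphic_ham : ∀ j, ContMDiff I 𝓘(ℂ, ℂ) ω (f j)
  hamiltonian : ∀ (j : ι) (x : X) (v : TangentSpace I x),
    σ x (mfderiv 𝓘(ℂ, ℂ) I (fun z : ℂ => θ (Pi.single j z) x) 0 (1 : ℂ)) v
      = mfderiv I 𝓘(ℂ, ℂ) (f j) x v
  invariant : ∀ j t x, f j (θ t x) = f j x

/-- The zero level set of a moment map, with the subspace topology. -/
abbrev ZeroLevel {X A : Type*} [Zero A] (Φ : X → A) : Type _ := {x : X // Φ x = 0}

/-- The space of orbits in the zero level set, with the quotient topology. -/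
abbrev OrbitSpace {G X A : Type*} [Zero A] (act : G → X → X) (Φ : X → A) : Type _ :=
  Quot (fun z z' : ZeroLevel Φ => ∃ g : G, act g z.1 = z'.1)

/-- The projection of the zero level set to the space of orbits. -/
abbrev OrbitSpace.proj {G X A : Type*} [Zero A] (act : G → X → X) (Φ : X → A) :
    ZeroLevel Φ → OrbitSpace act Φ :=
  Quot.mk _

/-- The given complex manifold structures on `Φ⁻¹(0)` and `Φ⁻¹(0)/G`, and the 2-form `σQ`, are those
of the symplectic quotient of `(X, σ)` at the zero level: `0` is a regular value of `Φ`, the level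
set is an embedded complex submanifold, the projection to the orbit space is a holomorphic
submersion, and `σQ` is the symplectic form whose pull-back to the level set is the restriction
of `σ`. -/
structure IsSymplecticQuotient {G A : Type*} [NormedAddCommGroup A] [NormedSpace ℂ A]
    (σ : TwoForm I X) (act : G → X → X) (Φ : X → A)
    {EZ : Type*} [NormedAddCommGroup EZ] [NormedSpace ℂ EZ] [ChartedSpace EZ (ZeroLevel Φ)]
    {EQ : Type*} [NormedAddCommGroup EQ] [NormedSpace ℂ EQ] [ChartedSpace EQ (OrbitSpace act Φ)]
    (σQ : TwoForm 𝓘(ℂ, EQ) (OrbitSpace act Φ)) : Prop where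
  regular : ∀ z : ZeroLevel Φ, Function.Surjective (mfderiv I 𝓘(ℂ, A) Φ z.1)
  level_manifold : IsManifold 𝓘(ℂ, EZ) ω (ZeroLevel Φ)
  incl_holomorphic : ContMDiff 𝓘(ℂ, EZ) I ω (Subtype.val : ZeroLevel Φ → X)
  incl_immersion : ∀ z : ZeroLevel Φ,
    Function.Injective (mfderiv 𝓘(ℂ, EZ) I (Subtype.val : ZeroLevel Φ → X) z)
  quot_manifold : IsManifold 𝓘(ℂ, EQ) ω (OrbitSpace act Φ)
  proj_holomorphic : ContMDiff 𝓘(ℂ, EZ) 𝓘(ℂ, EQ) ω (OrbitSpace.proj act Φ)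
  proj_submersion : ∀ z : ZeroLevel Φ,
    Function.Surjective (mfderiv 𝓘(ℂ, EZ) 𝓘(ℂ, EQ) (OrbitSpace.proj act Φ) z)
  symplectic : IsSymplecticForm σQ
  pullback : ∀ (z : ZeroLevel Φ) (v w : TangentSpace 𝓘(ℂ, EZ) z),
    σQ (OrbitSpace.proj act Φ z)
        (mfderiv 𝓘(ℂ, EZ) 𝓘(ℂ, EQ) (OrbitSpace.proj act Φ) z v)
        (mfderiv 𝓘(ℂ, EZ) 𝓘(ℂ, EQ) (OrbitSpace.proj act Φ) z w)
      = σ z.1 (mfderiv 𝓘(ℂ, EZ) I (Subtype.val : ZeroLevel Φ → X) z v)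
        (mfderiv 𝓘(ℂ, EZ) I (Subtype.val : ZeroLevel Φ → X) z w)

end Hamiltonian

/-! ### The product of the cotangent bundles of `GL(1), …, GL(n)` -/

section GelfandZeitlin

/-- The upper-left `m × m` minor of an `n × n` matrix. -/
noncomputable def upperLeft {m n : ℕ} (h : m ≤ n) (B : Matrix (Fin n) (Fin n) ℂ) : Matrix (Fin m) (Fin m) ℂ :=
  B.submatrix (Fin.castLE h) (Fin.castLE h)

/-- The embedding of `m × m` matrices in `(m + 1) × (m + 1)` matrices in the upper-left
corner, with `1` in the remaining diagonal entry. -/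
noncomputable def cornerHom (m : ℕ) :
    Matrix (Fin m) (Fin m) ℂ →* Matrix (Fin (m + 1)) (Fin (m + 1)) ℂ where
  toFun g := Matrix.reindex finSumFinEquiv finSumFinEquiv
    (Matrix.fromBlocks g 0 0 (1 : Matrix (Fin 1) (Fin 1) ℂ))
  map_one' := by simp
  map_mul' g h := by
    rw [Matrix.reindex_apply, Matrix.reindex_apply, Matrix.reindex_apply,
      Matrix.submatrix_mul_equiv, Matrix.fromBlocks_multiply]
    simp

/-- `GL(m)` as the group of upper-left minors in `GL(m + 1)`. -/
noncomputable def corner (m : ℕ) : GL (Fin m) ℂ →* GL (Fin (m + 1)) ℂ := Units.map (cornerHom m)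

/-- The algebra `𝔤𝔩(1) × ⋯ × 𝔤𝔩(k + 1)`; the factor with index `j : Fin (k + 1)` is `𝔤𝔩(j + 1)`.
Its group of units is `GL(1) × ⋯ × GL(k + 1)`, see `MulEquiv.piUnits`. -/
abbrev GlProd (k : ℕ) : Type := ∀ j : Fin (k + 1), Matrix (Fin (j + 1)) (Fin (j + 1)) ℂ

/-- The trace form functional of `𝔤𝔩(1) × ⋯ × 𝔤𝔩(k + 1)`: the sum of the traces. -/
noncomputable def trProd (k : ℕ) : GlProd k →ₗ[ℂ] ℂ :=
  ∑ j : Fin (k + 1), Matrix.traceLinearMap (Fin (j + 1)) ℂ ℂ ∘ₗ LinearMap.proj j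

/-- The product of `M` and of the cotangent bundles `T*GL(j) ≃ GL(j) × 𝔤𝔩(j)` (in the
trivialisation by right-invariant forms and the trace form), for `j = 1, …, k + 1`. -/
abbrev ExtSpace (k : ℕ) (M : Type*) := M × ((GlProd k)ˣ × GlProd k)

/-- The model with corners of `ExtSpace k M`. -/
noncomputable abbrev extModel (k : ℕ) (E : Type*) [NormedAddCommGroup E] [NormedSpace ℂ E] :=
  𝓘(ℂ, E).prod (𝓘(ℂ, GlProd k).prod 𝓘(ℂ, GlProd k))

/-- The bilinear form `tr (ρ b' - ρ' b - B [ρ, ρ'])`, summed over the factors, on the tangent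
space of `T*GL(1) × ⋯ × T*GL(k + 1)` at `(g, B)`, where a tangent vector `u` of the group at `g`
is written as `u = ρ g`. -/
noncomputable def cotangentBilin {k : ℕ} (g : (GlProd k)ˣ) (B : GlProd k) :
    GlProd k × GlProd k →ₗ[ℂ] GlProd k × GlProd k →ₗ[ℂ] ℂ :=
  LinearMap.mk₂ ℂ
    (fun v w : GlProd k × GlProd k =>
      trProd k ((v.1 * (g⁻¹ : (GlProd k)ˣ)) * w.2 - (w.1 * (g⁻¹ : (GlProd k)ˣ)) * v.2
        - B * ⁅v.1 * (g⁻¹ : (GlProd k)ˣ), w.1 * (g⁻¹ : (GlProd k)ˣ)⁆))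
    (by
      intro v v' w
      rw [← map_add]; congr 1
      simp only [Prod.fst_add, Prod.snd_add, Ring.lie_def]; noncomm_ring)
    (by
      intro c v w
      rw [← map_smul]; congr 1
      simp only [Prod.smul_fst, Prod.smul_snd, Ring.lie_def, smul_mul_assoc, mul_smul_comm,
        smul_sub, mul_sub])
    (by
      intro v w w'
      rw [← map_add]; congr 1
      simp only [Prod.fst_add, Prod.snd_add, Ring.lie_def]; noncomm_ring)
    (by
      intro c v w
      rw [← map_smul]; congr 1
      simp only [Prod.smul_fst, Prod.smul_snd, Ring.lie_def, smul_mul_assoc, mul_smul_comm,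
        smul_sub, mul_sub])

variable {E : Type*} [NormedAddCommGroup E] [NormedSpace ℂ E]
  {M : Type*} [TopologicalSpace M] [ChartedSpace E M]

/-- The product symplectic form on `M × T*GL(1) × ⋯ × T*GL(k + 1)`. The tangent space at
`(p, g, B)` is `E × 𝔤 × 𝔤`, where `𝔤` is the product of the `𝔤𝔩(j)`. -/
noncomputable def extForm (k : ℕ) (σ : TwoForm 𝓘(ℂ, E) M) : TwoForm (extModel k E) (ExtSpace k M) := fun x =>
  let b : E →ₗ[ℂ] E →ₗ[ℂ] ℂ := σ x.1
  (b.compl₁₂ (LinearMap.fst ℂ E (GlProd k × GlProd k))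
      (LinearMap.fst ℂ E (GlProd k × GlProd k))
    + (cotangentBilin x.2.1 x.2.2).compl₁₂ (LinearMap.snd ℂ E (GlProd k × GlProd k))
      (LinearMap.snd ℂ E (GlProd k × GlProd k)) :
    E × GlProd k × GlProd k →ₗ[ℂ] E × GlProd k × GlProd k →ₗ[ℂ] ℂ)

/-- The element of `GL(1) × ⋯ × GL(k + 1)` by which `h = (h₁, …, h_{k+1})` acts on the left:
`GL(i)` acts on the left of `T*GL(i + 1)` as the group of upper-left minors, and nothing acts
on the left of `T*GL(1)`. -/
noncomputable def leftPart {k : ℕ} (h : (GlProd k)ˣ) : (GlProd k)ˣ :=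
  MulEquiv.piUnits.symm
    (Fin.cases (motive := fun j : Fin (k + 1) => GL (Fin (j + 1)) ℂ) 1
      (fun i : Fin k => corner _ (MulEquiv.piUnits h i.castSucc)))

/-- The action of `GL(1) × ⋯ × GL(k + 1)` on `M × T*GL(1) × ⋯ × T*GL(k + 1)`: the factor
`GL(k + 1)` acts on `M`, each `GL(i)` acts on the right of `T*GL(i)` by `(g, B) ↦ (g h⁻¹, B)`, and
each `GL(i)`, `i ≤ k`, acts on the left of `T*GL(i + 1)` by `(g, B) ↦ (h g, h B h⁻¹)`. -/
noncomputable def extAct {k : ℕ} [MulAction (GL (Fin (k + 1)) ℂ) M] (h : (GlProd k)ˣ) (x : ExtSpace k M) :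
    ExtSpace k M :=
  let hn : GL (Fin (k + 1)) ℂ := MulEquiv.piUnits h (Fin.last k)
  (hn • x.1,
    (leftPart h * x.2.1 * h⁻¹, leftPart h * x.2.2 * ((leftPart h)⁻¹ : (GlProd k)ˣ)))

/-- The moment map of `extAct`: its components are `μ(p) - g⁻¹ B g` in `𝔤𝔩(k + 1)`, and
`(B_{j+1})_{(j)} - g_j⁻¹ B_j g_j` in `𝔤𝔩(j)` for `j ≤ k`. -/
noncomputable def extMoment {k : ℕ} (μ : M → Matrix (Fin (k + 1)) (Fin (k + 1)) ℂ) (x : ExtSpace k M) :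
    GlProd k :=
  Fin.lastCases (motive := fun j : Fin (k + 1) => Matrix (Fin (j + 1)) (Fin (j + 1)) ℂ)
      (μ x.1) (fun i : Fin k => upperLeft (Nat.le_succ _) (x.2.2 i.succ))
    - (x.2.1⁻¹ : (GlProd k)ˣ) * x.2.2 * x.2.1

/-- The index set of `∏ C_m`, `C_m ≃ ℂ^m`: the pair `⟨m, i⟩` stands for the Hamiltonian
`tr (B_{m+1})^(i+1)` on `T*GL(m + 1)`, where `i + 1 ≤ m + 1`. -/
abbrev GZIndex (k : ℕ) : Type := Σ m : Fin (k + 1), Fin (m + 1)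

/-- The Hamiltonians `tr (B_{m+1})^(i+1)` on `M × T*GL(1) × ⋯ × T*GL(k + 1)`. -/
noncomputable def gzHam {k : ℕ} (a : GZIndex k) (x : ExtSpace k M) : ℂ :=
  (x.2.2 a.1 ^ ((a.2 : ℕ) + 1)).trace

/-- The exponential with values in the group `GL(1) × ⋯ × GL(k + 1)`. -/
noncomputable def expUnit {k : ℕ} (a : GlProd k) : (GlProd k)ˣ := (NormedSpace.isUnit_exp a).unit

/-- The action of `∏ C_m` on `M × T*GL(1) × ⋯ × T*GL(k + 1)`, each `C_m` acting only on `T*GL(m)`, by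
the flows `z ⬝ (g, B) = (exp (i z B^(i-1)) g, B)` of the Hamiltonians `tr B^i`. -/
noncomputable def gzAct {k : ℕ} (t : GZIndex k → ℂ) (x : ExtSpace k M) : ExtSpace k M :=
  (x.1,
    (expUnit (fun m : Fin (k + 1) =>
        ∑ i : Fin (m + 1), (((i : ℕ) + 1 : ℂ) * t ⟨m, i⟩) • x.2.2 m ^ (i : ℕ)) * x.2.1,
      x.2.2))

end GelfandZeitlin

/-! ### Transport of manifold structures along homeomorphisms -/

/-! The proof is a gauge fixing. On the group components the action reads `g ↦ leftPart h * g *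
h⁻¹`, where slot `j + 1` of `leftPart h` is `h_j` placed in the upper-left corner and slot `1` is
`1`. The condition that the result be `1`, that is `h = leftPart h * g`, is triangular: `h₁ = g₁`
and `h_{j+1} = corner(h_j) g_{j+1}`. It has exactly one solution, `gaugeUnit g`, which depends
holomorphically on `g`. Once `g = 1`, the vanishing of the moment map says that the last `B` is
`μ(p)` and that each other `B_j` is the upper-left block of `B_{j+1}`, so the `B_j` are the blocks
of `μ(p)` (`eq_minors`). Hence `p ↦ (p, (1, minors (μ p)))` meets every orbit in the zero level
exactly once and with trivial stabilizer, the zero level is `M × H`, and the orbit space is `M`.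

The passage from such a global slice to a symplectic quotient is general (`IsGlobalSlice`). In the
trivialization `(p, h) ↦ h ⬝ s p` the ambient form pulls back to the form of `M` (`pullback_act`):
orbit directions lie in the kernel because the moment map is constant on the level, the action is
symplectic, and `s` pulls the ambient form back to that of `M`. The last point holds here because
`g` is constant on the slice and the fibres of a cotangent bundle are isotropic. The manifold
structures of the level and of the orbit space are transported from `M × H` and `M`.

A Hamiltonian vector action that commutes with `H` and preserves the moment map descends to `p ↦ r
(θ t (s p))`, where `r` retracts along orbits. Its Hamiltonians are the restrictions to the slice,
again by `pullback_act` (`isHamiltonianVectorAction_slice`). For the flows of `tr B^i` these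
restrictions are the traces of powers of the blocks of `μ`.

What remains is explicit. The group of units is open in its algebra, so tangent vectors are elements
of the algebra, and the symplectic and moment identities become identities between traces.
Regularity of the moment map follows by varying `B` alone. -/

section Transport

/-- The charted space structure on `Z` transported along a homeomorphism to a charted space `N`. -/
abbrev Homeomorph.transportChartedSpace {H Z N : Type*} [TopologicalSpace H] [TopologicalSpace Z]
    [TopologicalSpace N] [ChartedSpace H N] (e : Z ≃ₜ N) : ChartedSpace H Z where
  atlas := e.transOpenPartialHomeomorph '' atlas H N
  chartAt z := e.transOpenPartialHomeomorph (chartAt H (e z))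
  mem_chart_source z := by simp
  chart_mem_atlas z := ⟨_, chart_mem_atlas H (e z), rfl⟩

variable {E : Type*} [NormedAddCommGroup E] [NormedSpace ℂ E]
  {H : Type*} [TopologicalSpace H] {I : ModelWithCorners ℂ E H}
  {Z N : Type*} [TopologicalSpace Z] [TopologicalSpace N] [ChartedSpace H N]

theorem Homeomorph.isManifold_transport (e : Z ≃ₜ N) [IsManifold I ω N] :
    letI := e.transportChartedSpace (H := H)
    IsManifold I ω Z := by
  let _ := e.transportChartedSpace (H := H)
  refine IsManifold.mk' (gr := ⟨?_⟩) ..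
  rintro _ _ ⟨c, hc, rfl⟩ ⟨c', hc', rfl⟩
  have h := (contDiffGroupoid ω I).compatible hc hc'
  refine (contDiffGroupoid ω I).mem_of_eqOnSource h ⟨?_, ?_⟩
  · ext x; simp
  · intro x hx; simp

theorem Homeomorph.chartAt_transport (e : Z ≃ₜ N) (z : Z) :
    letI := e.transportChartedSpace (H := H)
    chartAt H z = e.transOpenPartialHomeomorph (chartAt H (e z)) :=
  rfl

theorem Homeomorph.extChartAt_transport (e : Z ≃ₜ N) (z : Z) :
    letI := e.transportChartedSpace (H := H)
    extChartAt I z = e.toEquiv.toPartialEquiv.trans (extChartAt I (e z)) := by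
  let _ := e.transportChartedSpace (H := H)
  ext x <;> simp [extChartAt, e.chartAt_transport]

theorem Homeomorph.contMDiff_transport (e : Z ≃ₜ N) :
    letI := e.transportChartedSpace (H := H)
    ContMDiff I I ω e := by
  let _ := e.transportChartedSpace (H := H)
  intro z
  rw [contMDiffAt_iff]
  refine ⟨e.continuous.continuousAt, ?_⟩
  have h := (contMDiffAt_iff.1 (contMDiffAt_id (I := I) (n := ω) (x := e z))).2
  rw [e.extChartAt_transport]
  convert h using 1
  · ext x; simp
  · simp

theorem Homeomorph.contMDiff_symm_transport (e : Z ≃ₜ N) :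
    letI := e.transportChartedSpace (H := H)
    ContMDiff I I ω e.symm := by
  let _ := e.transportChartedSpace (H := H)
  intro z
  rw [contMDiffAt_iff]
  refine ⟨e.symm.continuous.continuousAt, ?_⟩
  have h := (contMDiffAt_iff.1 (contMDiffAt_id (I := I) (n := ω) (x := z))).2
  rw [e.extChartAt_transport]
  convert h using 1
  ext x; simp

/-- The preferred charts at `z` and at `e z` differ by `e`, so `e` reads as the identity in them.
Tangent spaces on both sides are the same `E`, and pulling back forms requires no linear map. -/
theorem Homeomorph.hasMFDerivAt_transport (e : Z ≃ₜ N) (z : Z) :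
    letI := e.transportChartedSpace (H := H)
    HasMFDerivAt I I e z (ContinuousLinearMap.id ℂ E) := by
  let _ := e.transportChartedSpace (H := H)
  refine ⟨e.continuous.continuousAt, ?_⟩
  have hw : writtenInExtChartAt I I z e = writtenInExtChartAt I I (e z) id := by
    ext x; simp [writtenInExtChartAt, e.chartAt_transport]
  have hz : extChartAt I z z = extChartAt I (e z) (e z) := by simp [e.chartAt_transport]
  rw [hw, hz]
  exact (hasMFDerivAt_id (I := I) (e z)).2

theorem Homeomorph.hasMFDerivAt_symm_transport (e : Z ≃ₜ N) (x : N) :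
    letI := e.transportChartedSpace (H := H)
    HasMFDerivAt I I e.symm x (ContinuousLinearMap.id ℂ E) := by
  let _ := e.transportChartedSpace (H := H)
  refine ⟨e.symm.continuous.continuousAt, ?_⟩
  have hw : writtenInExtChartAt I I x e.symm = writtenInExtChartAt I I x id := by
    ext y; simp [writtenInExtChartAt, e.chartAt_transport]
  rw [hw]
  exact (hasMFDerivAt_id (I := I) x).2

/-- The 2-form transported along a homeomorphism, for the transported charted space. -/
def Homeomorph.transportForm (e : Z ≃ₜ N) (σ : TwoForm I N) :
    letI := e.transportChartedSpace (H := H)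
    TwoForm I Z :=
  fun z => σ (e z)

theorem Homeomorph.transportForm_inChart (e : Z ≃ₜ N) [I.Boundaryless] [IsManifold I ω N]
    (σ : TwoForm I N) (z₀ : Z)
    (v w : E) {y : E} (hy : y ∈ (extChartAt I (e z₀)).target) :
    letI := e.transportChartedSpace (H := H)
    TwoForm.inChart (e.transportForm σ) z₀ v w y = σ.inChart (e z₀) v w y := by
  let _ := e.transportChartedSpace (H := H)
  have h : ((extChartAt I z₀).symm : E → Z) = e.symm ∘ (extChartAt I (e z₀)).symm := by
    rw [e.extChartAt_transport]; rfl
  have h1 : MDifferentiableAt 𝓘(ℂ, E) I (extChartAt I (e z₀)).symm y :=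
    ((contMDiffOn_extChartAt_symm (n := ω) (e z₀)).contMDiffAt
      ((isOpen_extChartAt_target (e z₀)).mem_nhds hy)).mdifferentiableAt (by simp)
  have h2 : HasMFDerivAt 𝓘(ℂ, E) I (extChartAt I z₀).symm y
      (mfderiv 𝓘(ℂ, E) I (extChartAt I (e z₀)).symm y) := by
    rw [h]
    exact (e.hasMFDerivAt_symm_transport _).comp y h1.hasMFDerivAt
  unfold TwoForm.inChart
  rw [h2.mfderiv]
  have h3 : e ((extChartAt I z₀).symm y) = (extChartAt I (e z₀)).symm y := by
    rw [h]; simp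
  exact h3 ▸ rfl

theorem Homeomorph.isSymplecticForm_transport (e : Z ≃ₜ N) [I.Boundaryless] [IsManifold I ω N]
    {σ : TwoForm I N}
    (hσ : IsSymplecticForm σ) :
    letI := e.transportChartedSpace (H := H)
    IsSymplecticForm (e.transportForm σ) := by
  let _ := e.transportChartedSpace (H := H)
  have ht (z₀ : Z) : (extChartAt I z₀).target = (extChartAt I (e z₀)).target := by
    rw [e.extChartAt_transport]; simp
  have key (z₀ : Z) (v w : E) :
      Set.EqOn (TwoForm.inChart (e.transportForm σ) z₀ v w) (σ.inChart (e z₀) v w)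
        (extChartAt I (e z₀)).target := fun y hy => e.transportForm_inChart σ z₀ v w hy
  refine ⟨fun z₀ v w => ?_, fun z v => hσ.alternating (e z) v, fun z₀ u v w y hy => ?_,
    fun z v => hσ.nondegenerate (e z) v⟩
  · rw [ht]
    exact (hσ.holomorphic (e z₀) v w).congr (key z₀ v w)
  · rw [ht] at hy
    have hf (v w : E) : fderiv ℂ (TwoForm.inChart (e.transportForm σ) z₀ v w) y
        = fderiv ℂ (σ.inChart (e z₀) v w) y :=
      ((key z₀ v w).eventuallyEq_of_mem ((isOpen_extChartAt_target (e z₀)).mem_nhds hy)).fderiv_eq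
    rw [hf, hf, hf]
    exact hσ.closed (e z₀) u v w y hy

end Transport

/-! ### Derivatives of maps to groups of units -/

section Units

variable {A : Type*} [NormedRing A] [NormedAlgebra ℂ A] [CompleteSpace A]
  {E : Type*} [NormedAddCommGroup E] [NormedSpace ℂ E]
  {H : Type*} [TopologicalSpace H] {I : ModelWithCorners ℂ E H}
  {X : Type*} [TopologicalSpace X] [ChartedSpace H X]

/-- The chart of the open subset `Aˣ` is the inclusion itself. A tangent vector at `g` is therefore
a plain element `u` of `A`, and its right-invariant form is `u * g⁻¹`. -/
theorem Units.hasMFDerivAt_val (g : Aˣ) :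
    HasMFDerivAt 𝓘(ℂ, A) 𝓘(ℂ, A) (Units.val : Aˣ → A) g (ContinuousLinearMap.id ℂ A) := by
  refine ⟨Units.continuous_val.continuousAt, ?_⟩
  have hg : (extChartAt 𝓘(ℂ, A) g) g = (g : A) := rfl
  have h : writtenInExtChartAt 𝓘(ℂ, A) 𝓘(ℂ, A) g (Units.val : Aˣ → A)
      =ᶠ[nhds ((extChartAt 𝓘(ℂ, A) g) g)] id := by
    filter_upwards [extChartAt_target_mem_nhds (I := 𝓘(ℂ, A)) g] with y hy
    exact (extChartAt 𝓘(ℂ, A) g).right_inv hy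
  exact ((hasFDerivAt_id _).congr_of_eventuallyEq h).hasFDerivWithinAt

/-- Reduces derivatives of group-valued maps to derivatives in the algebra, where the product and
inverse rules apply. -/
theorem Units.hasMFDerivAt_of_val {f : X → Aˣ} {x : X} {f' : TangentSpace I x →L[ℂ] A}
    (hf : MDifferentiableAt I 𝓘(ℂ, A) f x)
    (h : HasMFDerivAt I 𝓘(ℂ, A) (fun y => (f y : A)) x f') :
    HasMFDerivAt I 𝓘(ℂ, A) f x f' := by
  have h1 := (Units.hasMFDerivAt_val (f x)).comp x hf.hasMFDerivAt
  have h2 := hasMFDerivAt_unique h1 h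
  convert hf.hasMFDerivAt using 1
  rw [← h2]
  rfl

theorem Units.contMDiff_of_val {f : X → Aˣ} (h : ContMDiff I 𝓘(ℂ, A) ω (fun y => (f y : A))) :
    ContMDiff I 𝓘(ℂ, A) ω f :=
  ContMDiff.of_comp_isOpenEmbedding Units.isOpenEmbedding_val h

end Units

/-! ### Symplectic quotients of Hamiltonian actions with a global slice -/

section Slice

variable {EX : Type*} [NormedAddCommGroup EX] [NormedSpace ℂ EX]
  {HX : Type*} [TopologicalSpace HX] {I : ModelWithCorners ℂ EX HX}
  {X : Type*} [TopologicalSpace X] [ChartedSpace HX X]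
  {A : Type*} [NormedRing A] [NormedAlgebra ℂ A] [CompleteSpace A]
  {E : Type*} [NormedAddCommGroup E] [NormedSpace ℂ E]
  {M : Type*} [TopologicalSpace M] [ChartedSpace E M]

/-- The map `s : M → X` is a global slice for the action `act` on the zero level set of `Φ`: every
point `x` of the level set is `γ x ⬝ s (r x)` in a unique way. -/
structure IsGlobalSlice (I : ModelWithCorners ℂ EX HX) (act : Aˣ → X → X) (Φ : X → A)
    (s : M → X) (r : X → M) (γ : X → Aˣ) : Prop where
  holomorphic_slice : ContMDiff 𝓘(ℂ, E) I ω s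
  holomorphic_retraction : ContMDiff I 𝓘(ℂ, E) ω r
  holomorphic_gauge : ContMDiff I 𝓘(ℂ, A) ω γ
  moment_slice : ∀ p, Φ (s p) = 0
  act_slice : ∀ x, Φ x = 0 → act (γ x) (s (r x)) = x
  retraction_act : ∀ h p, r (act h (s p)) = p
  gauge_act : ∀ h p, γ (act h (s p)) = h

variable {τ : A →ₗ[ℂ] ℂ} {σX : TwoForm I X} {act : Aˣ → X → X} {Φ : X → A}
  {s : M → X} {r : X → M} {γ : X → Aˣ}

namespace IsHamiltonianAction

theorem moment_act (hΦ : IsHamiltonianAction τ σX act Φ) {x : X} (hx : Φ x = 0) (g : Aˣ) :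
    Φ (act g x) = 0 := by
  rw [hΦ.equivariant, hx]; simp

theorem holomorphic_act_left (hΦ : IsHamiltonianAction τ σX act Φ) (g : Aˣ) :
    ContMDiff I I ω (act g) :=
  hΦ.holomorphic_act.comp (contMDiff_const.prodMk contMDiff_id)

theorem holomorphic_act_right (hΦ : IsHamiltonianAction τ σX act Φ) (x : X) :
    ContMDiff 𝓘(ℂ, A) I ω (fun g => act g x) :=
  hΦ.holomorphic_act.comp (contMDiff_id.prodMk contMDiff_const)

/-- Since `g ⬝ x = (g h⁻¹) ⬝ (h ⬝ x)`, right translation moves the derivative at `h` to the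
identity. There it is the vector field generated by `u * h⁻¹`, to which the moment map condition
applies. -/
theorem mfderiv_orbit (hΦ : IsHamiltonianAction τ σX act Φ) (h : Aˣ) (x : X) (u : A) :
    mfderiv 𝓘(ℂ, A) I (fun g => act g x) h u
      = mfderiv 𝓘(ℂ, A) I (fun g => act g (act h x)) 1 (u * (h⁻¹ : Aˣ) : A) := by
  have h1 : (fun g => act g x) = (fun g => act g (act h x)) ∘ (fun g : Aˣ => g * h⁻¹) := by
    funext g
    simp [← hΦ.mul_act]
  have h3 : ContMDiff 𝓘(ℂ, A) 𝓘(ℂ, A) ω (fun g : Aˣ => g * h⁻¹) :=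
    contMDiff_id.mul contMDiff_const
  have h2 : HasMFDerivAt 𝓘(ℂ, A) 𝓘(ℂ, A) (fun g : Aˣ => g * h⁻¹) h
      ((ContinuousLinearMap.mul ℂ A).flip ((h⁻¹ : Aˣ) : A)) :=
    Units.hasMFDerivAt_of_val (h3.mdifferentiable (by simp) h)
      (((ContinuousLinearMap.mul ℂ A).flip ((h⁻¹ : Aˣ) : A)).hasMFDerivAt.comp h
        (Units.hasMFDerivAt_val h))
  have h4 := ((hΦ.holomorphic_act_right (act h x)).mdifferentiable (by simp) (h * h⁻¹)).hasMFDerivAt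
  have h5 := h4.comp h h2
  rw [← h1] at h5
  rw [h5.mfderiv]
  have h6 : h * h⁻¹ = 1 := mul_inv_cancel h
  rw [← h6]
  rfl

end IsHamiltonianAction

namespace IsGlobalSlice

/-- The core of symplectic reduction in the trivialization of the level: orbit directions are null,
and along a translate of the slice the invariance of the form leaves only its pull-back by `s`. -/
theorem pullback_act [FiniteDimensional ℂ A] (hs : IsGlobalSlice (E := E) I act Φ s r γ)
    (hΦ : IsHamiltonianAction τ σX act Φ) (halt : ∀ x v, σX x v v = 0)
    {σ : TwoForm 𝓘(ℂ, E) M}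
    (hσ : ∀ p v w, σX (s p) (mfderiv 𝓘(ℂ, E) I s p v) (mfderiv 𝓘(ℂ, E) I s p w) = σ p v w)
    (q : M × Aˣ) (v w : E × A) :
    σX (act q.2 (s q.1))
        (mfderiv (𝓘(ℂ, E).prod 𝓘(ℂ, A)) I (fun q : M × Aˣ => act q.2 (s q.1)) q v)
        (mfderiv (𝓘(ℂ, E).prod 𝓘(ℂ, A)) I (fun q : M × Aˣ => act q.2 (s q.1)) q w)
      = σ q.1 v.1 w.1 := by
  obtain ⟨p, h⟩ := q
  set F : M × Aˣ → X := fun q => act q.2 (s q.1) with hF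
  have cF : ContMDiff (𝓘(ℂ, E).prod 𝓘(ℂ, A)) I ω F :=
    hΦ.holomorphic_act.comp (contMDiff_snd.prodMk (hs.holomorphic_slice.comp contMDiff_fst))
  have dF := cF.mdifferentiable (by simp) (p, h)
  let D : E × A →L[ℂ] TangentSpace I (act h (s p)) :=
    mfderiv (𝓘(ℂ, E).prod 𝓘(ℂ, A)) I F (p, h)
  have D1 (a : E) : D (a, 0)
      = mfderiv I I (act h) (s p) (mfderiv 𝓘(ℂ, E) I s p a) := by
    have h1 : HasMFDerivAt 𝓘(ℂ, E) (𝓘(ℂ, E).prod 𝓘(ℂ, A)) (fun p' : M => (p', h)) p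
        ((ContinuousLinearMap.id ℂ E).prod (0 : E →L[ℂ] A)) :=
      (hasMFDerivAt_id p).prodMk (hasMFDerivAt_const h p)
    have h2 := dF.hasMFDerivAt.comp p h1
    have h3 := ((hΦ.holomorphic_act_left h).mdifferentiable (by simp) (s p)).hasMFDerivAt.comp p
      (hs.holomorphic_slice.mdifferentiable (by simp) p).hasMFDerivAt
    exact DFunLike.congr_fun (hasMFDerivAt_unique h2 h3) a
  have D2 (u : A) : D (0, u)
      = mfderiv 𝓘(ℂ, A) I (fun g => act g (act h (s p))) 1 (u * (h⁻¹ : Aˣ) : A) := by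
    have h1 : HasMFDerivAt 𝓘(ℂ, A) (𝓘(ℂ, E).prod 𝓘(ℂ, A)) (fun h' : Aˣ => (p, h')) h
        ((0 : A →L[ℂ] E).prod (ContinuousLinearMap.id ℂ A)) :=
      (hasMFDerivAt_const p h).prodMk (hasMFDerivAt_id h)
    have h2 := dF.hasMFDerivAt.comp h h1
    rw [← hΦ.mfderiv_orbit]
    have h3 := ((hΦ.holomorphic_act_right (s p)).mdifferentiable (by simp) h).hasMFDerivAt
    exact DFunLike.congr_fun (hasMFDerivAt_unique h2 h3) u
  -- The pairing is the derivative of a component of `Φ` along a direction tangent to the zero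
  -- level, on which `Φ` is constant.
  have hker (u : A) (b : E × A) : σX (act h (s p)) (D (0, u)) (D b) = 0 := by
    rw [D2, hΦ.moment]
    have c1 : MDifferentiableAt I 𝓘(ℂ, ℂ)
        (fun y => τ (Φ y * (u * (h⁻¹ : Aˣ)))) (act h (s p)) :=
      (τ ∘ₗ LinearMap.mulRight ℂ (u * (h⁻¹ : Aˣ))).toContinuousLinearMap.mdifferentiableAt.comp
        (act h (s p)) (hΦ.holomorphic_moment.mdifferentiable (by simp) _)
    have h1 := c1.hasMFDerivAt.comp (p, h) dF.hasMFDerivAt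
    have h2 : (fun y => τ (Φ y * (u * (h⁻¹ : Aˣ)))) ∘ F = fun _ => 0 := by
      funext q
      simp [hF, hΦ.moment_act (hs.moment_slice q.1)]
    rw [h2] at h1
    have h3 := hasMFDerivAt_unique h1 (hasMFDerivAt_const 0 (p, h))
    exact DFunLike.congr_fun h3 b
  have hsplit (b : E × A) : D b = D (b.1, 0) + D (0, b.2) := by
    rw [← map_add]; simp
  have hanti (x y : TangentSpace I (act h (s p))) :
      σX (act h (s p)) x y = - σX (act h (s p)) y x := by
    have := halt (act h (s p)) (x + y)
    simp only [map_add, LinearMap.add_apply, halt, zero_add, add_zero] at this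
    exact eq_neg_of_add_eq_zero_right this
  change σX (act h (s p)) (D v) (D w) = _
  rw [hsplit v, map_add, LinearMap.add_apply, hker, add_zero, hsplit w, map_add,
    hanti _ (D (0, w.2)), hker, neg_zero, add_zero, D1, D1, hΦ.symplectic]
  exact hσ p v.1 w.1

end IsGlobalSlice

end Slice

/-! ### The reduced manifold, its form and residual actions, from a global slice -/

section SliceQuotient

variable {EX : Type*} [NormedAddCommGroup EX] [NormedSpace ℂ EX]
  {HX : Type*} [TopologicalSpace HX] {I : ModelWithCorners ℂ EX HX}
  {X : Type*} [TopologicalSpace X] [ChartedSpace HX X]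
  {A : Type*} [NormedRing A] [NormedAlgebra ℂ A] [CompleteSpace A]
  {E : Type*} [NormedAddCommGroup E] [NormedSpace ℂ E]
  {M : Type*} [TopologicalSpace M] [ChartedSpace E M]
  {τ : A →ₗ[ℂ] ℂ} {σX : TwoForm I X} {act : Aˣ → X → X} {Φ : X → A}
  {s : M → X} {r : X → M} {γ : X → Aˣ}

namespace IsGlobalSlice

theorem retraction_slice (hs : IsGlobalSlice (E := E) I act Φ s r γ)
    (hΦ : IsHamiltonianAction τ σX act Φ) (p : M) : r (s p) = p := by
  rw [← hΦ.one_act (s p), hs.retraction_act]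

theorem retraction_invariant (hs : IsGlobalSlice (E := E) I act Φ s r γ)
    (hΦ : IsHamiltonianAction τ σX act Φ) {x : X} (hx : Φ x = 0) (g : Aˣ) :
    r (act g x) = r x := by
  conv_lhs => rw [← hs.act_slice x hx, ← hΦ.mul_act]
  exact hs.retraction_act _ _

/-- The zero level set of a Hamiltonian action with a global slice is a trivial principal bundle. -/
def levelHomeomorph (hs : IsGlobalSlice (E := E) I act Φ s r γ)
    (hΦ : IsHamiltonianAction τ σX act Φ) : ZeroLevel Φ ≃ₜ M × Aˣ where
  toFun z := (r z.1, γ z.1)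
  invFun q := ⟨act q.2 (s q.1), hΦ.moment_act (hs.moment_slice q.1) q.2⟩
  left_inv z := Subtype.ext (hs.act_slice z.1 z.2)
  right_inv _ := Prod.ext (hs.retraction_act _ _) (hs.gauge_act _ _)
  continuous_toFun := (hs.holomorphic_retraction.continuous.prodMk
    hs.holomorphic_gauge.continuous).comp continuous_subtype_val
  continuous_invFun := (hΦ.holomorphic_act.continuous.comp
    (continuous_snd.prodMk (hs.holomorphic_slice.continuous.comp continuous_fst))).subtype_mk _

/-- The orbit space of the zero level set is homeomorphic to a global slice. -/
def orbitHomeomorph (hs : IsGlobalSlice (E := E) I act Φ s r γ)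
    (hΦ : IsHamiltonianAction τ σX act Φ) : OrbitSpace act Φ ≃ₜ M where
  toFun := Quot.lift (fun z => r z.1) (by
    rintro z z' ⟨g, hg⟩
    rw [← hg, hs.retraction_invariant hΦ z.2])
  invFun p := OrbitSpace.proj act Φ ⟨s p, hs.moment_slice p⟩
  left_inv := by
    rintro ⟨z⟩
    exact Quot.sound ⟨γ z.1, hs.act_slice z.1 z.2⟩
  right_inv p := hs.retraction_slice hΦ p
  continuous_toFun := continuous_quot_lift _
    (hs.holomorphic_retraction.continuous.comp continuous_subtype_val)
  continuous_invFun := continuous_quot_mk.comp (hs.holomorphic_slice.continuous.subtype_mk _)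

/-- The manifold structure of the zero level set of an action with a global slice. -/
noncomputable abbrev levelChartedSpace (hs : IsGlobalSlice (E := E) I act Φ s r γ)
    (hΦ : IsHamiltonianAction τ σX act Φ) : ChartedSpace (E × A) (ZeroLevel Φ) :=
  (hs.levelHomeomorph hΦ).transportChartedSpace (H := ModelProd E A)

/-- The manifold structure of the orbit space of an action with a global slice. -/
noncomputable abbrev orbitChartedSpace (hs : IsGlobalSlice (E := E) I act Φ s r γ)
    (hΦ : IsHamiltonianAction τ σX act Φ) : ChartedSpace E (OrbitSpace act Φ) :=
  (hs.orbitHomeomorph hΦ).transportChartedSpace (H := E)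

theorem isManifold_level (hs : IsGlobalSlice (E := E) I act Φ s r γ)
    (hΦ : IsHamiltonianAction τ σX act Φ) [IsManifold 𝓘(ℂ, E) ω M] :
    letI := hs.levelChartedSpace hΦ
    IsManifold 𝓘(ℂ, E × A) ω (ZeroLevel Φ) := by
  rw [modelWithCornersSelf_prod]
  exact (hs.levelHomeomorph hΦ).isManifold_transport (I := 𝓘(ℂ, E).prod 𝓘(ℂ, A))

theorem contMDiff_level (hs : IsGlobalSlice (E := E) I act Φ s r γ)
    (hΦ : IsHamiltonianAction τ σX act Φ) :
    letI := hs.levelChartedSpace hΦ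
    ContMDiff 𝓘(ℂ, E × A) (𝓘(ℂ, E).prod 𝓘(ℂ, A)) ω (hs.levelHomeomorph hΦ) := by
  rw [modelWithCornersSelf_prod]
  exact (hs.levelHomeomorph hΦ).contMDiff_transport (I := 𝓘(ℂ, E).prod 𝓘(ℂ, A))

theorem hasMFDerivAt_level (hs : IsGlobalSlice (E := E) I act Φ s r γ)
    (hΦ : IsHamiltonianAction τ σX act Φ) (z : ZeroLevel Φ) :
    letI := hs.levelChartedSpace hΦ
    HasMFDerivAt 𝓘(ℂ, E × A) (𝓘(ℂ, E).prod 𝓘(ℂ, A)) (hs.levelHomeomorph hΦ) z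
      (ContinuousLinearMap.id ℂ (E × A)) := by
  rw [modelWithCornersSelf_prod]
  exact (hs.levelHomeomorph hΦ).hasMFDerivAt_transport (I := 𝓘(ℂ, E).prod 𝓘(ℂ, A)) z

theorem contMDiff_trivialization (hs : IsGlobalSlice (E := E) I act Φ s r γ)
    (hΦ : IsHamiltonianAction τ σX act Φ) [IsManifold 𝓘(ℂ, E) ω M] :
    ContMDiff (𝓘(ℂ, E).prod 𝓘(ℂ, A)) I ω (fun q : M × Aˣ => act q.2 (s q.1)) :=
  hΦ.holomorphic_act.comp (contMDiff_snd.prodMk (hs.holomorphic_slice.comp contMDiff_fst))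

theorem val_eq (hs : IsGlobalSlice (E := E) I act Φ s r γ)
    (hΦ : IsHamiltonianAction τ σX act Φ) : (Subtype.val : ZeroLevel Φ → X)
    = (fun q : M × Aˣ => act q.2 (s q.1)) ∘ hs.levelHomeomorph hΦ :=
  funext fun z => (hs.act_slice z.1 z.2).symm

theorem proj_eq (hs : IsGlobalSlice (E := E) I act Φ s r γ)
    (hΦ : IsHamiltonianAction τ σX act Φ) : OrbitSpace.proj act Φ
    = (hs.orbitHomeomorph hΦ).symm ∘ Prod.fst ∘ hs.levelHomeomorph hΦ :=
  funext fun z => ((hs.orbitHomeomorph hΦ).symm_apply_apply (OrbitSpace.proj act Φ z)).symm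

/-- In the trivialization the inclusion of the level becomes `(p, h) ↦ h ⬝ s p` and the projection
becomes `(p, h) ↦ p`, so the pull-back condition is `pullback_act`. -/
theorem isSymplecticQuotient (hs : IsGlobalSlice (E := E) I act Φ s r γ)
    (hΦ : IsHamiltonianAction τ σX act Φ) [FiniteDimensional ℂ A] [IsManifold 𝓘(ℂ, E) ω M]
    (halt : ∀ x v, σX x v v = 0)
    (hreg : ∀ x, Φ x = 0 → Function.Surjective (mfderiv I 𝓘(ℂ, A) Φ x))
    {σ : TwoForm 𝓘(ℂ, E) M} (hsymp : IsSymplecticForm σ)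
    (hσ : ∀ p v w, σX (s p) (mfderiv 𝓘(ℂ, E) I s p v) (mfderiv 𝓘(ℂ, E) I s p w) = σ p v w) :
    letI := hs.levelChartedSpace hΦ
    letI := hs.orbitChartedSpace hΦ
    IsSymplecticQuotient (EZ := E × A) σX act Φ ((hs.orbitHomeomorph hΦ).transportForm σ) := by
  let _ := hs.levelChartedSpace hΦ
  let _ := hs.orbitChartedSpace hΦ
  have hF := hs.contMDiff_trivialization hΦ
  have hval (z : ZeroLevel Φ) := (hF.mdifferentiable (by simp)
    (hs.levelHomeomorph hΦ z)).hasMFDerivAt.comp z (hs.hasMFDerivAt_level hΦ z)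
  rw [← hs.val_eq hΦ] at hval
  have hproj (z : ZeroLevel Φ) : HasMFDerivAt 𝓘(ℂ, E × A) 𝓘(ℂ, E) (OrbitSpace.proj act Φ) z
      (ContinuousLinearMap.fst ℂ E A) := by
    rw [hs.proj_eq hΦ]
    exact ((hs.orbitHomeomorph hΦ).hasMFDerivAt_symm_transport (I := 𝓘(ℂ, E)) _).comp z
      ((hasMFDerivAt_fst (hs.levelHomeomorph hΦ z)).comp z (hs.hasMFDerivAt_level hΦ z))
  refine ⟨fun z => hreg z.1 z.2, hs.isManifold_level hΦ, ?_, fun z => ?_,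
    (hs.orbitHomeomorph hΦ).isManifold_transport, ?_, fun z => ?_,
    (hs.orbitHomeomorph hΦ).isSymplecticForm_transport hsymp, fun z v w => ?_⟩
  · rw [hs.val_eq hΦ]
    exact hF.comp (hs.contMDiff_level hΦ)
  -- Immersion: `x ↦ (r x, γ x)` is a holomorphic left inverse of the trivialization, so the
  -- derivative of the latter has a left inverse.
  · rw [(hval z).mfderiv]
    have h1 := ((hs.holomorphic_retraction.prodMk hs.holomorphic_gauge).mdifferentiable (by simp)
      z.1).hasMFDerivAt
    rw [← hs.act_slice z.1 z.2] at h1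
    have h2 := h1.comp (hs.levelHomeomorph hΦ z)
      (hF.mdifferentiable (by simp) (hs.levelHomeomorph hΦ z)).hasMFDerivAt
    have h3 : (fun x => (r x, γ x)) ∘ (fun q : M × Aˣ => act q.2 (s q.1)) = id :=
      funext fun q => Prod.ext (hs.retraction_act _ _) (hs.gauge_act _ _)
    rw [h3] at h2
    have h4 := hasMFDerivAt_unique h2 (hasMFDerivAt_id _)
    exact Function.LeftInverse.injective (DFunLike.congr_fun h4)
  · rw [hs.proj_eq hΦ]
    exact ((hs.orbitHomeomorph hΦ).contMDiff_symm_transport (I := 𝓘(ℂ, E))).comp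
      (contMDiff_fst.comp (hs.contMDiff_level hΦ))
  · rw [(hproj z).mfderiv]
    exact Prod.fst_surjective
  · rw [(hproj z).mfderiv, (hval z).mfderiv]
    have h := hs.pullback_act hΦ halt hσ (hs.levelHomeomorph hΦ z) v w
    -- The base points are equal only propositionally; as all tangent spaces are `EX`, the values of
    -- the form can still be compared.
    have hx : ∀ x, x = z.1 → ∀ a b : EX, σX x a b = σX z.1 a b := by
      rintro _ rfl _ _
      rfl
    exact h.symm.trans (hx _ (hs.act_slice z.1 z.2) _ _)

/-- The symplectic quotient by an action with a global slice is biholomorphic to the slice. -/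
noncomputable def orbitDiffeomorph (hs : IsGlobalSlice (E := E) I act Φ s r γ)
    (hΦ : IsHamiltonianAction τ σX act Φ) :
    letI := hs.orbitChartedSpace hΦ
    M ≃ₘ^ω⟮𝓘(ℂ, E), 𝓘(ℂ, E)⟯ OrbitSpace act Φ :=
  letI := hs.orbitChartedSpace hΦ
  { toEquiv := (hs.orbitHomeomorph hΦ).symm.toEquiv
    contMDiff_toFun := (hs.orbitHomeomorph hΦ).contMDiff_symm_transport
    contMDiff_invFun := (hs.orbitHomeomorph hΦ).contMDiff_transport }

theorem orbitDiffeomorph_symplectic (hs : IsGlobalSlice (E := E) I act Φ s r γ)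
    (hΦ : IsHamiltonianAction τ σX act Φ) (σ : TwoForm 𝓘(ℂ, E) M) (p : M)
    (v w : TangentSpace 𝓘(ℂ, E) p) :
    letI := hs.orbitChartedSpace hΦ
    (hs.orbitHomeomorph hΦ).transportForm σ (hs.orbitDiffeomorph hΦ p)
        (mfderiv 𝓘(ℂ, E) 𝓘(ℂ, E) (hs.orbitDiffeomorph hΦ) p v)
        (mfderiv 𝓘(ℂ, E) 𝓘(ℂ, E) (hs.orbitDiffeomorph hΦ) p w) = σ p v w := by
  let _ := hs.orbitChartedSpace hΦ
  have h : HasMFDerivAt 𝓘(ℂ, E) 𝓘(ℂ, E) (hs.orbitDiffeomorph hΦ) p (ContinuousLinearMap.id ℂ E) :=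
    (hs.orbitHomeomorph hΦ).hasMFDerivAt_symm_transport p
  rw [h.mfderiv]
  have hx : ∀ x, x = p → ∀ a b : E, σ x a b = σ p a b := by
    rintro _ rfl _ _
    rfl
  exact hx _ ((hs.orbitHomeomorph hΦ).apply_symm_apply p) v w

/-- A vector action on `X` which commutes with `act`, has `Φ` as invariant, and has Hamiltonians
invariant under `act`, induces a Hamiltonian vector action on a global slice. -/
theorem isHamiltonianVectorAction_slice [FiniteDimensional ℂ A] [IsManifold 𝓘(ℂ, E) ω M]
    (hs : IsGlobalSlice (E := E) I act Φ s r γ) (hΦ : IsHamiltonianAction τ σX act Φ)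
    (halt : ∀ x v, σX x v v = 0) {σ : TwoForm 𝓘(ℂ, E) M}
    (hσ : ∀ p v w, σX (s p) (mfderiv 𝓘(ℂ, E) I s p v) (mfderiv 𝓘(ℂ, E) I s p w) = σ p v w)
    {ι : Type*} [Fintype ι] [DecidableEq ι] {θ : (ι → ℂ) → X → X} {f : ι → X → ℂ}
    (hθ : IsHamiltonianVectorAction σX θ f)
    (hcomm : ∀ t h x, θ t (act h x) = act h (θ t x))
    (hinv : ∀ t x, Φ (θ t x) = Φ x) (hf : ∀ j h x, f j (act h x) = f j x) :
    IsHamiltonianVectorAction σ (fun t p => r (θ t (s p))) (fun j p => f j (s p)) := by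
  have h0 (t p) : Φ (θ t (s p)) = 0 := (hinv t _).trans (hs.moment_slice p)
  have hfr (j x) (hx : Φ x = 0) : f j (s (r x)) = f j x := by
    conv_rhs => rw [← hs.act_slice x hx, hf]
  have hrθ (t x) (hx : Φ x = 0) : r (θ t (s (r x))) = r (θ t x) := by
    conv_rhs => rw [← hs.act_slice x hx, hcomm, hs.retraction_invariant hΦ (h0 t _)]
  refine ⟨fun p => ?_, fun t u p => ?_, ?_, fun j => ?_, fun j p v => ?_, fun j t p => ?_⟩
  · rw [hθ.zero_act, hs.retraction_slice hΦ]
  · rw [hθ.add_act, hrθ t _ (h0 u p)]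
  · exact hs.holomorphic_retraction.comp (hθ.holomorphic_act.comp
      (contMDiff_fst.prodMk (hs.holomorphic_slice.comp contMDiff_snd)))
  · exact (hθ.holomorphic_ham j).comp hs.holomorphic_slice
  · set F : M × Aˣ → X := fun q => act q.2 (s q.1) with hF
    let c : ℂ → X := fun z => θ (Pi.single j z) (s p)
    have hc : ContMDiff 𝓘(ℂ, ℂ) I ω c := hθ.holomorphic_act.comp
      ((ContDiff.contMDiff (contDiff_single (𝕜 := ℂ) (F' := fun _ : ι => ℂ) ω j)).prodMk
        contMDiff_const)
    have c0 : c 0 = s p := by simp [c, hθ.zero_act]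
    let D : E × A →L[ℂ] EX := mfderiv (𝓘(ℂ, E).prod 𝓘(ℂ, A)) I F (p, 1)
    have hD : HasMFDerivAt (𝓘(ℂ, E).prod 𝓘(ℂ, A)) I F (p, 1) D :=
      ((hs.contMDiff_trivialization hΦ).mdifferentiable (by simp) (p, 1)).hasMFDerivAt
    have hF1 : F (p, 1) = s p := hΦ.one_act _
    let R : ℂ →L[ℂ] E := mfderiv 𝓘(ℂ, ℂ) 𝓘(ℂ, E) (r ∘ c) 0
    have hR : HasMFDerivAt 𝓘(ℂ, ℂ) 𝓘(ℂ, E) (r ∘ c) 0 R :=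
      ((hs.holomorphic_retraction.comp hc).mdifferentiable (by simp) 0).hasMFDerivAt
    let G : ℂ →L[ℂ] A := mfderiv 𝓘(ℂ, ℂ) 𝓘(ℂ, A) (γ ∘ c) 0
    have hG : HasMFDerivAt 𝓘(ℂ, ℂ) 𝓘(ℂ, A) (γ ∘ c) 0 G :=
      ((hs.holomorphic_gauge.comp hc).mdifferentiable (by simp) 0).hasMFDerivAt
    have hq : ((r ∘ c) 0, (γ ∘ c) 0) = (p, (1 : Aˣ)) := by
      simp only [Function.comp_apply, c0, ← hF1]
      exact Prod.ext (hs.retraction_act 1 p) (hs.gauge_act 1 p)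
    -- The flow line `c` stays in the zero level, so it factors through the trivialization. Its
    -- velocity splits into the reduced velocity `R 1` and an orbit part `G 1`, which `pullback_act`
    -- discards.
    have hcD : HasMFDerivAt 𝓘(ℂ, ℂ) I c 0 (D.comp (R.prod G)) := by
      have h1 : c = F ∘ (fun z => ((r ∘ c) z, (γ ∘ c) z)) :=
        funext fun z => (hs.act_slice _ (h0 _ p)).symm
      rw [h1]
      refine HasMFDerivAt.comp (g := F) 0 ?_ (hR.prodMk hG)
      rw [hq]
      exact hD
    have hsD : HasMFDerivAt 𝓘(ℂ, E) I s p (D.comp (ContinuousLinearMap.inl ℂ E A)) := by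
      have h1 : s = F ∘ (fun p' => (p', 1)) := funext fun p' => (hΦ.one_act _).symm
      rw [h1]
      exact hD.comp p ((hasMFDerivAt_id p).prodMk (hasMFDerivAt_const 1 p))
    have h2 := hs.pullback_act hΦ halt hσ (p, 1) (R 1, G 1) (v, 0)
    have h3 := hθ.hamiltonian j (s p) (D (v, 0))
    rw [show (fun z : ℂ => θ (Pi.single j z) (s p)) = c from rfl, hcD.mfderiv] at h3
    have h4 := ((hθ.holomorphic_ham j).mdifferentiable (by simp) (s p)).hasMFDerivAt.comp p hsD
    have hx : ∀ x, x = s p → ∀ a b : EX, σX x a b = σX (s p) a b := by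
      rintro _ rfl _ _
      rfl
    refine Eq.trans ?_ (DFunLike.congr_fun h4.mfderiv v).symm
    refine Eq.trans ?_ h3
    exact h2.symm.trans (hx _ hF1 _ _)
  · rw [hfr j _ (h0 t p), hθ.invariant]

end IsGlobalSlice

end SliceQuotient

/-! ### Products of symplectic forms -/

section Product

variable {E F : Type*} [NormedAddCommGroup E] [NormedSpace ℂ E]
  [NormedAddCommGroup F] [NormedSpace ℂ F]
  {H K : Type*} [TopologicalSpace H] [TopologicalSpace K]
  {I : ModelWithCorners ℂ E H} {J : ModelWithCorners ℂ F K}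
  {X Y : Type*} [TopologicalSpace X] [ChartedSpace H X] [TopologicalSpace Y] [ChartedSpace K Y]

/-- The sum of the pull-backs of two 2-forms to the product manifold. -/
noncomputable def TwoForm.prod (σ : TwoForm I X) (ρ : TwoForm J Y) :
    TwoForm (I.prod J) (X × Y) := fun x =>
  let b : E →ₗ[ℂ] E →ₗ[ℂ] ℂ := σ x.1
  let c : F →ₗ[ℂ] F →ₗ[ℂ] ℂ := ρ x.2
  (b.compl₁₂ (LinearMap.fst ℂ E F) (LinearMap.fst ℂ E F)
    + c.compl₁₂ (LinearMap.snd ℂ E F) (LinearMap.snd ℂ E F) :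
    E × F →ₗ[ℂ] E × F →ₗ[ℂ] ℂ)

theorem mdifferentiableAt_extChartAt_symm [I.Boundaryless] [IsManifold I ω X] (x : X) {y : E}
    (hy : y ∈ (extChartAt I x).target) : MDifferentiableAt 𝓘(ℂ, E) I (extChartAt I x).symm y :=
  ((contMDiffOn_extChartAt_symm (n := ω) x).contMDiffAt
    ((isOpen_extChartAt_target x).mem_nhds hy)).mdifferentiableAt (by simp)

theorem TwoForm.prod_inChart [I.Boundaryless] [IsManifold I ω X] [J.Boundaryless]
    [IsManifold J ω Y] (σ : TwoForm I X) (ρ : TwoForm J Y) (x : X × Y) (v w : E × F) {y : E × F}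
    (hy : y ∈ (extChartAt (I.prod J) x).target) :
    (σ.prod ρ).inChart x v w y
      = σ.inChart x.1 v.1 w.1 y.1 + ρ.inChart x.2 v.2 w.2 y.2 := by
  rw [extChartAt_prod] at hy
  have h1 := (mdifferentiableAt_extChartAt_symm (I := I) x.1 hy.1).hasMFDerivAt.comp y
    (ContinuousLinearMap.fst ℂ E F).hasMFDerivAt
  have h2 := (mdifferentiableAt_extChartAt_symm (I := J) x.2 hy.2).hasMFDerivAt.comp y
    (ContinuousLinearMap.snd ℂ E F).hasMFDerivAt
  have h3 := (h1.prodMk h2).mfderiv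
  have h4 : ((extChartAt (I.prod J) x).symm : E × F → X × Y)
      = fun z => (((extChartAt I x.1).symm ∘ ContinuousLinearMap.fst ℂ E F) z,
        ((extChartAt J x.2).symm ∘ ContinuousLinearMap.snd ℂ E F) z) := by
    rw [extChartAt_prod]; rfl
  unfold TwoForm.inChart
  rw [h4]
  erw [h3]
  rfl

theorem IsSymplecticForm.prod [I.Boundaryless] [IsManifold I ω X] [J.Boundaryless]
    [IsManifold J ω Y] {σ : TwoForm I X} {ρ : TwoForm J Y} (hσ : IsSymplecticForm σ)
    (hρ : IsSymplecticForm ρ) : IsSymplecticForm (σ.prod ρ) := by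
  have ht (x : X × Y) : (extChartAt (I.prod J) x).target
      = (extChartAt I x.1).target ×ˢ (extChartAt J x.2).target := by
    rw [extChartAt_prod]; rfl
  refine ⟨fun x v w => ?_, fun x v => ?_, fun x u v w y hy => ?_, fun x v hv => ?_⟩
  · refine ContDiffOn.congr (f := fun y => σ.inChart x.1 v.1 w.1 y.1 + ρ.inChart x.2 v.2 w.2 y.2)
      ?_ (fun y hy => TwoForm.prod_inChart σ ρ x v w hy)
    rw [ht]
    exact ((hσ.holomorphic x.1 v.1 w.1).comp contDiffOn_fst fun y hy => hy.1).add
      ((hρ.holomorphic x.2 v.2 w.2).comp contDiffOn_snd fun y hy => hy.2)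
  · change σ x.1 _ _ + ρ x.2 _ _ = 0
    exact (congrArg₂ (· + ·) (hσ.alternating x.1 _) (hρ.alternating x.2 _)).trans (add_zero 0)
  · have hy' := hy
    rw [ht] at hy'
    have hd (v w u : E × F) : fderiv ℂ ((σ.prod ρ).inChart x v w) y u
        = fderiv ℂ (σ.inChart x.1 v.1 w.1) y.1 u.1 + fderiv ℂ (ρ.inChart x.2 v.2 w.2) y.2 u.2 := by
      have h0 : (σ.prod ρ).inChart x v w =ᶠ[nhds y]
          fun y => σ.inChart x.1 v.1 w.1 y.1 + ρ.inChart x.2 v.2 w.2 y.2 := by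
        filter_upwards [(isOpen_extChartAt_target x).mem_nhds hy] with z hz
        exact TwoForm.prod_inChart σ ρ x v w hz
      have h1 : DifferentiableAt ℂ (σ.inChart x.1 v.1 w.1) y.1 :=
        ((hσ.holomorphic x.1 v.1 w.1).contDiffAt
          ((isOpen_extChartAt_target x.1).mem_nhds hy'.1)).differentiableAt (by simp)
      have h2 : DifferentiableAt ℂ (ρ.inChart x.2 v.2 w.2) y.2 :=
        ((hρ.holomorphic x.2 v.2 w.2).contDiffAt
          ((isOpen_extChartAt_target x.2).mem_nhds hy'.2)).differentiableAt (by simp)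
      have h3 := (h1.hasFDerivAt.comp y hasFDerivAt_fst).add (h2.hasFDerivAt.comp y hasFDerivAt_snd)
      rw [(h3.congr_of_eventuallyEq h0).fderiv]
      rfl
    rw [hd, hd, hd]
    have h1 := hσ.closed x.1 u.1 v.1 w.1 y.1 hy'.1
    have h2 := hρ.closed x.2 u.2 v.2 w.2 y.2 hy'.2
    linear_combination h1 + h2
  · refine Prod.ext (hσ.nondegenerate x.1 v.1 fun w => ?_) (hρ.nondegenerate x.2 v.2 fun w => ?_)
    · refine Eq.trans ?_ (hv ((w, 0) : E × F))
      change _ = σ x.1 v.1 w + ρ x.2 v.2 0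
      rw [map_zero, add_zero]
    · refine Eq.trans ?_ (hv ((0, w) : E × F))
      change _ = σ x.1 v.1 0 + ρ x.2 v.2 w
      rw [map_zero, zero_add]

end Product

/-! ### The symplectic form of the cotangent bundle of a group of units -/

section Cotangent

variable {A : Type*} [NormedRing A] [NormedAlgebra ℂ A] [CompleteSpace A] {τ : A →L[ℂ] ℂ}

/-- The chart is the inclusion in `A × A`, so constant vectors of the model stay constant and the
chart expression is the form itself. -/
theorem TwoForm.inChart_units_prod (ρ : TwoForm (𝓘(ℂ, A).prod 𝓘(ℂ, A)) (Aˣ × A)) (x : Aˣ × A)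
    (v w : A × A)
    {y : A × A}
    (hy : y ∈ (extChartAt (𝓘(ℂ, A).prod 𝓘(ℂ, A)) x).target) :
    ∃ g : Aˣ, (g : A) = y.1 ∧
      ρ.inChart x v w y = ρ (g, y.2) v w := by
  rw [extChartAt_prod] at hy
  have hc : HasMFDerivAt 𝓘(ℂ, A) 𝓘(ℂ, A) (extChartAt 𝓘(ℂ, A) x.1).symm y.1
      (ContinuousLinearMap.id ℂ (A)) := by
    refine Units.hasMFDerivAt_of_val (mdifferentiableAt_extChartAt_symm x.1 hy.1) ?_
    refine (hasMFDerivAt_id y.1).congr_of_eventuallyEq ?_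
    filter_upwards [(isOpen_extChartAt_target x.1).mem_nhds hy.1] with z hz
    exact (extChartAt 𝓘(ℂ, A) x.1).right_inv hz
  have h1 := hc.comp y (ContinuousLinearMap.fst ℂ (A) (A)).hasMFDerivAt
  have h2 := (ContinuousLinearMap.snd ℂ (A) (A)).hasMFDerivAt (x := y)
  have h3 := (h1.prodMk h2).mfderiv
  have h4 : ((extChartAt (𝓘(ℂ, A).prod 𝓘(ℂ, A)) x).symm :
        A × A → Aˣ × A)
      = fun z => (((extChartAt 𝓘(ℂ, A) x.1).symm
          ∘ ContinuousLinearMap.fst ℂ (A) (A)) z,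
        ContinuousLinearMap.snd ℂ (A) (A) z) := by
    rw [extChartAt_prod]; rfl
  refine ⟨(extChartAt 𝓘(ℂ, A) x.1).symm y.1,
    (extChartAt 𝓘(ℂ, A) x.1).right_inv hy.1, ?_⟩
  unfold TwoForm.inChart
  rw [h4]
  erw [h3]
  rfl

/-- The form of the cotangent bundle in the coordinates of matrices. -/
noncomputable def cotangentCoord (τ : A →L[ℂ] ℂ) (v w y : A × A) : ℂ :=
  τ ((v.1 * Ring.inverse y.1) * w.2 - (w.1 * Ring.inverse y.1) * v.2
    - y.2 * ((v.1 * Ring.inverse y.1) * (w.1 * Ring.inverse y.1)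
      - (w.1 * Ring.inverse y.1) * (v.1 * Ring.inverse y.1)))

theorem contDiffAt_cotangentCoord (τ : A →L[ℂ] ℂ) (v w : A × A) {y : A × A}
    (hy : IsUnit y.1) : ContDiffAt ℂ ω (cotangentCoord τ v w) y := by
  obtain ⟨g, hg⟩ := hy
  have h : ContDiffAt ℂ ω (fun y : A × A => Ring.inverse y.1) y :=
    ContDiffAt.comp y (hg ▸ contDiffAt_ringInverse ℂ g) contDiffAt_fst
  have hv (v : A × A) :
      ContDiffAt ℂ ω (fun y : A × A => v.1 * Ring.inverse y.1) y :=
    contDiffAt_const.mul h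
  exact (τ).contDiff.contDiffAt.comp y
    ((((hv v).mul contDiffAt_const).sub ((hv w).mul contDiffAt_const)).sub
      (contDiffAt_snd.mul (((hv v).mul (hv w)).sub ((hv w).mul (hv v)))))

/-- Along the line `y + t u` the inverse of the group component has derivative `-g⁻¹ u₁ g⁻¹`, so `b
= v₁ g⁻¹` changes by `-b a`, and `c` by `-c a`. -/
theorem fderiv_cotangentCoord (τ : A →L[ℂ] ℂ) (u v w : A × A) {y : A × A}
    {g : Aˣ} (hg : (g : A) = y.1) {a b c : A}
    (ha : a = u.1 * (g⁻¹ : Aˣ)) (hb : b = v.1 * (g⁻¹ : Aˣ))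
    (hc : c = w.1 * (g⁻¹ : Aˣ)) :
    fderiv ℂ (cotangentCoord τ v w) y u
      = τ (-(b * a) * w.2 + (c * a) * v.2 - u.2 * (b * c - c * b)
        + y.2 * (b * a * c + b * c * a - c * a * b - c * b * a)) := by
  have hline : HasDerivAt (fun t : ℂ => y + t • u) u 0 := by
    simpa only [id, one_smul] using ((hasDerivAt_id (0 : ℂ)).smul_const u).const_add y
  have hy0 : y + (0 : ℂ) • u = y := by simp
  have hP : HasDerivAt (fun t : ℂ => Ring.inverse (y + t • u).1)
      (-((g⁻¹ : Aˣ) * u.1 * (g⁻¹ : Aˣ))) 0 := by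
    have h1 := (hasFDerivAt_ringInverse (𝕜 := ℂ) g)
    have h2 : HasDerivAt (fun t : ℂ => (y + t • u).1) u.1 0 := 
      (ContinuousLinearMap.fst ℂ (A) (A)).hasFDerivAt.comp_hasDerivAt 0 hline
    have h3 : (g : A) = (y + (0 : ℂ) • u).1 := by rw [hy0, hg]
    rw [h3] at h1
    exact h1.comp_hasDerivAt 0 h2
  have hP1 : Ring.inverse y.1 = (g⁻¹ : Aˣ) := by rw [← hg, Ring.inverse_unit]
  have hB : HasDerivAt (fun t : ℂ => (y + t • u).2) u.2 0 :=
    (ContinuousLinearMap.snd ℂ (A) (A)).hasFDerivAt.comp_hasDerivAt 0 hline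
  have hv := hP.const_mul v.1
  have hw := hP.const_mul w.1
  have hall := (τ).hasFDerivAt.comp_hasDerivAt 0
    (((hv.mul_const w.2).sub (hw.mul_const v.2)).sub
      (hB.mul ((hv.mul hw).sub (hw.mul hv))))
  have hf := ((contDiffAt_cotangentCoord τ v w (y := y) ⟨g, hg⟩).differentiableAt
    (by simp)).hasFDerivAt
  rw [← hy0] at hf
  have hf2 := hf.comp_hasDerivAt 0 hline
  have := hf2.unique hall
  rw [hy0] at this
  rw [this]
  simp only [hy0, hP1, Pi.sub_apply, Pi.mul_apply]
  congr 1
  subst ha hb hc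
  noncomm_ring

/-- Closedness uses only that `τ` vanishes on commutators. For nondegeneracy, vertical test vectors
`(0, b)` kill the group part of `v`, and then the vectors `(b g, 0)` kill its fibre part. -/
theorem isSymplecticForm_of_eq_cotangent {ρ : TwoForm (𝓘(ℂ, A).prod 𝓘(ℂ, A)) (Aˣ × A)}
    (hρ : ∀ (x : Aˣ × A) (v w : A × A), ρ x v w = τ ((v.1 * (x.1⁻¹ : Aˣ)) * w.2
      - (w.1 * (x.1⁻¹ : Aˣ)) * v.2 - x.2 * ⁅v.1 * (x.1⁻¹ : Aˣ), w.1 * (x.1⁻¹ : Aˣ)⁆))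
    (hcomm : ∀ a b, τ (a * b) = τ (b * a)) (hnd : ∀ a, (∀ b, τ (a * b) = 0) → a = 0) :
    IsSymplecticForm ρ := by
  have hcoord (x : Aˣ × A) (v w : A × A) :
      Set.EqOn (ρ.inChart x v w) (cotangentCoord τ v w)
        (extChartAt (𝓘(ℂ, A).prod 𝓘(ℂ, A)) x).target := fun y hy => by
    obtain ⟨g, hg, h⟩ := ρ.inChart_units_prod x v w hy
    rw [h, hρ, cotangentCoord, ← hg, Ring.inverse_unit]
    rfl
  refine ⟨fun x v w => ?_, fun x v => ?_, fun x u v w y hy => ?_, fun x v hv => ?_⟩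
  · refine ContDiffOn.congr (fun y hy => ?_) (hcoord x v w)
    obtain ⟨g, hg, -⟩ := ρ.inChart_units_prod x v w hy
    exact (contDiffAt_cotangentCoord τ v w ⟨g, hg⟩).contDiffWithinAt
  · refine (hρ x v v).trans ?_
    simp [Ring.lie_def]
  · obtain ⟨g, hg, -⟩ := ρ.inChart_units_prod x v w hy
    have hd (v w) := ((hcoord x v w).eventuallyEq_of_mem
      ((isOpen_extChartAt_target x).mem_nhds hy)).fderiv_eq (𝕜 := ℂ)
    rw [hd, hd, hd, fderiv_cotangentCoord τ u v w hg rfl rfl rfl,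
      fderiv_cotangentCoord τ v w u hg rfl rfl rfl, fderiv_cotangentCoord τ w u v hg rfl rfl rfl]
    generalize u.1 * (g⁻¹ : Aˣ) = a
    generalize v.1 * (g⁻¹ : Aˣ) = b
    generalize w.1 * (g⁻¹ : Aˣ) = c
    have key (p q r : A) : τ (p * q * r) = τ (r * (p * q)) :=
      hcomm _ _
    rw [← map_add, ← map_add]
    have h1 := key b a w.2
    have h2 := key a b w.2
    have h3 := key c a v.2
    have h4 := key a c v.2
    have h5 := key b c u.2
    have h6 := key c b u.2
    -- The cyclic sum of derivatives equals this combination of six commutators; the terms cubic in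
    -- `a`, `b`, `c` cancel identically.
    have h7 : τ (- (b * a * w.2 - w.2 * (b * a)) + (a * b * w.2 - w.2 * (a * b))
        + (c * a * v.2 - v.2 * (c * a)) - (a * c * v.2 - v.2 * (a * c))
        + (b * c * u.2 - u.2 * (b * c)) - (c * b * u.2 - u.2 * (c * b))) = 0 := by
      simp only [map_add, map_sub, map_neg, h1, h2, h3, h4, h5, h6]
      ring
    rw [← h7]
    congr 1
    noncomm_ring
  · have hv' (w : A × A) : ρ x v w = 0 := hv w
    obtain ⟨v1, v2⟩ := v
    have h1 : v1 * (x.1⁻¹ : Aˣ) = 0 := hnd _ fun b => by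
      have := hv' (0, b)
      rw [hρ] at this
      simpa [Ring.lie_def] using this
    have h1' : v1 = 0 := by simpa using h1
    have h2 : v2 = 0 := hnd _ fun b => by
      have := hv' (b * x.1, 0)
      rw [hρ] at this
      simp only [h1', Ring.lie_def, zero_mul, mul_zero, sub_zero, zero_sub, map_neg,
        neg_eq_zero, Units.mul_inv_cancel_right] at this
      rw [hcomm, this]
    exact Prod.ext h1' h2

end Cotangent

/-! ### The trace form on the product of the `𝔤𝔩(j)` and the symplectic form of the extended space
-/

section GlProd

variable {k : ℕ}

theorem trProd_apply (a : GlProd k) : trProd k a = ∑ j, (a j).trace := by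
  simp [trProd]

theorem trProd_mul_comm (a b : GlProd k) : trProd k (a * b) = trProd k (b * a) := by
  simp only [trProd_apply, Pi.mul_apply]
  exact Finset.sum_congr rfl fun j _ => Matrix.trace_mul_comm _ _

theorem trProd_mul_single (a : GlProd k) (j : Fin (k + 1))
    (b : Matrix (Fin (j + 1)) (Fin (j + 1)) ℂ) :
    trProd k (a * Pi.single j b) = (a j * b).trace := by
  rw [trProd_apply, Finset.sum_eq_single j]
  · simp
  · intro i _ hi
    simp [Pi.single_eq_of_ne hi]
  · simp

theorem eq_zero_of_trProd_mul {a : GlProd k} (h : ∀ b, trProd k (a * b) = 0) : a = 0 := by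
  funext j
  refine Matrix.ext_iff_trace_mul_right.2 fun b => ?_
  rw [← trProd_mul_single, h]
  simp

/-- The symplectic form of the cotangent bundle. -/
noncomputable def cotangentForm (k : ℕ) :
    TwoForm (𝓘(ℂ, GlProd k).prod 𝓘(ℂ, GlProd k)) ((GlProd k)ˣ × GlProd k) :=
  fun x => cotangentBilin x.1 x.2

theorem cotangentBilin_apply (g : (GlProd k)ˣ) (B : GlProd k) (v w : GlProd k × GlProd k) :
    cotangentBilin g B v w = trProd k ((v.1 * (g⁻¹ : (GlProd k)ˣ)) * w.2
      - (w.1 * (g⁻¹ : (GlProd k)ˣ)) * v.2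
      - B * ⁅v.1 * (g⁻¹ : (GlProd k)ˣ), w.1 * (g⁻¹ : (GlProd k)ˣ)⁆) :=
  rfl

theorem isSymplecticForm_cotangentForm : IsSymplecticForm (cotangentForm k) :=
  isSymplecticForm_of_eq_cotangent (τ := (trProd k).toContinuousLinearMap)
    (fun x v w => cotangentBilin_apply x.1 x.2 v w) trProd_mul_comm
    fun _ => eq_zero_of_trProd_mul

variable {E : Type*} [NormedAddCommGroup E] [NormedSpace ℂ E]
    {M : Type*} [TopologicalSpace M] [ChartedSpace E M]

theorem extForm_apply (σ : TwoForm 𝓘(ℂ, E) M) (x : ExtSpace k M) (v w : E × GlProd k × GlProd k) :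
    extForm k σ x v w = σ x.1 v.1 w.1 + cotangentBilin x.2.1 x.2.2 v.2 w.2 :=
  rfl

theorem extForm_eq_prod (σ : TwoForm 𝓘(ℂ, E) M) : extForm k σ = σ.prod (cotangentForm k) := by
  funext x
  refine LinearMap.ext fun v => LinearMap.ext fun w => ?_
  exact extForm_apply σ x v w

theorem isSymplecticForm_extForm [IsManifold 𝓘(ℂ, E) ω M]
    {σ : TwoForm 𝓘(ℂ, E) M} (hσ : IsSymplecticForm σ) : IsSymplecticForm (extForm k σ) := by
  rw [extForm_eq_prod]
  exact hσ.prod isSymplecticForm_cotangentForm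

end GlProd

/-! ### The algebra of upper-left minors -/

section Corner

variable {m : ℕ}

/-- The linear embedding of `m × m` matrices in `(m + 1) × (m + 1)` matrices in the upper-left
corner, with `0` in the remaining diagonal entry. -/
noncomputable def cornerLin (m : ℕ) :
    Matrix (Fin m) (Fin m) ℂ →ₗ[ℂ] Matrix (Fin (m + 1)) (Fin (m + 1)) ℂ where
  toFun g := Matrix.reindex finSumFinEquiv finSumFinEquiv
    (Matrix.fromBlocks g 0 0 (0 : Matrix (Fin 1) (Fin 1) ℂ))
  map_add' g h := by
    have := Matrix.fromBlocks_add g 0 0 (0 : Matrix (Fin 1) (Fin 1) ℂ) h 0 0 0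
    rw [add_zero, add_zero, add_zero] at this
    rw [← this]; rfl
  map_smul' c g := by
    have := Matrix.fromBlocks_smul c g 0 0 (0 : Matrix (Fin 1) (Fin 1) ℂ)
    rw [smul_zero, smul_zero, smul_zero] at this
    rw [← this]; rfl

/-- The diagonal matrix unit in the lower-right entry. -/
noncomputable def cornerIdem (m : ℕ) : Matrix (Fin (m + 1)) (Fin (m + 1)) ℂ :=
  Matrix.reindex finSumFinEquiv finSumFinEquiv
    (Matrix.fromBlocks (0 : Matrix (Fin m) (Fin m) ℂ) 0 0 (1 : Matrix (Fin 1) (Fin 1) ℂ))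

/-- Being affine, the group embedding is holomorphic with constant derivative `cornerLin`. -/
theorem cornerHom_eq (g : Matrix (Fin m) (Fin m) ℂ) :
    cornerHom m g = cornerLin m g + cornerIdem m := by
  have := Matrix.fromBlocks_add g 0 0 (0 : Matrix (Fin 1) (Fin 1) ℂ) 0 0 0 1
  simp only [add_zero, zero_add] at this
  change Matrix.reindex finSumFinEquiv finSumFinEquiv _ = _
  rw [← this]; rfl

/-- The upper-left minor as a linear map. -/
noncomputable def upperLeftLin {m n : ℕ} (h : m ≤ n) :
    Matrix (Fin n) (Fin n) ℂ →ₗ[ℂ] Matrix (Fin m) (Fin m) ℂ where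
  toFun := upperLeft h
  map_add' _ _ := rfl
  map_smul' _ _ := rfl

theorem upperLeft_succ_apply (B : Matrix (Fin (m + 1)) (Fin (m + 1)) ℂ) (i j : Fin m) :
    upperLeft (Nat.le_succ m) B i j = B i.castSucc j.castSucc :=
  rfl

theorem cornerLin_castSucc (g : Matrix (Fin m) (Fin m) ℂ) (i j : Fin m) :
    cornerLin m g i.castSucc j.castSucc = g i j := by
  simp [cornerLin]

theorem cornerLin_last_left (g : Matrix (Fin m) (Fin m) ℂ) (j : Fin (m + 1)) :
    cornerLin m g (Fin.last m) j = 0 := by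
  cases j using Fin.lastCases <;> simp [cornerLin]

theorem cornerLin_last_right (g : Matrix (Fin m) (Fin m) ℂ) (i : Fin (m + 1)) :
    cornerLin m g i (Fin.last m) = 0 := by
  cases i using Fin.lastCases <;> simp [cornerLin]

theorem cornerHom_castSucc (g : Matrix (Fin m) (Fin m) ℂ) (i j : Fin m) :
    cornerHom m g i.castSucc j.castSucc = g i j := by
  simp [cornerHom]

theorem cornerHom_castSucc_last (g : Matrix (Fin m) (Fin m) ℂ) (i : Fin m) :
    cornerHom m g i.castSucc (Fin.last m) = 0 := by
  simp [cornerHom]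

theorem cornerHom_last_castSucc (g : Matrix (Fin m) (Fin m) ℂ) (i : Fin m) :
    cornerHom m g (Fin.last m) i.castSucc = 0 := by
  simp [cornerHom]

theorem upperLeft_cornerHom_mul (g : Matrix (Fin m) (Fin m) ℂ)
    (B : Matrix (Fin (m + 1)) (Fin (m + 1)) ℂ) :
    upperLeft (Nat.le_succ m) (cornerHom m g * B) = g * upperLeft (Nat.le_succ m) B := by
  ext i j
  rw [upperLeft_succ_apply, Matrix.mul_apply, Matrix.mul_apply, Fin.sum_univ_castSucc]
  simp only [cornerHom_castSucc, cornerHom_castSucc_last, upperLeft_succ_apply, zero_mul, add_zero]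

theorem upperLeft_mul_cornerHom (g : Matrix (Fin m) (Fin m) ℂ)
    (B : Matrix (Fin (m + 1)) (Fin (m + 1)) ℂ) :
    upperLeft (Nat.le_succ m) (B * cornerHom m g) = upperLeft (Nat.le_succ m) B * g := by
  ext i j
  rw [upperLeft_succ_apply, Matrix.mul_apply, Matrix.mul_apply, Fin.sum_univ_castSucc]
  simp only [cornerHom_castSucc, cornerHom_last_castSucc, upperLeft_succ_apply, mul_zero, add_zero]

/-- Corner embedding and block restriction are adjoint for the trace forms, which is why the left
action of `GL(m)` contributes an upper-left block to the moment map. -/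
theorem trace_cornerLin_mul (g : Matrix (Fin m) (Fin m) ℂ)
    (B : Matrix (Fin (m + 1)) (Fin (m + 1)) ℂ) :
    (cornerLin m g * B).trace = (g * upperLeft (Nat.le_succ m) B).trace := by
  simp only [Matrix.trace, Matrix.diag_apply, Matrix.mul_apply]
  rw [Fin.sum_univ_castSucc]
  simp only [Fin.sum_univ_castSucc (n := m), cornerLin_castSucc, cornerLin_last_left,
    cornerLin_last_right, upperLeft_succ_apply, zero_mul, add_zero, Finset.sum_const_zero]

end Corner

/-! ### Shifts between consecutive factors, and the two triangular systems -/

section GlProdAlgebra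

variable {k : ℕ}

/-- The shift of `𝔤𝔩(1) × ⋯ × 𝔤𝔩(k + 1)` that embeds each factor in the next one and forgets the
last one; it is the derivative of `leftPart`. -/
noncomputable def shiftUp (k : ℕ) : GlProd k →ₗ[ℂ] GlProd k :=
  LinearMap.pi (Fin.cases
    (motive := fun j : Fin (k + 1) => GlProd k →ₗ[ℂ] Matrix (Fin (j + 1)) (Fin (j + 1)) ℂ) 0
    (fun i : Fin k => cornerLin _ ∘ₗ LinearMap.proj i.castSucc))

/-- The adjoint of `shiftUp`, which takes the upper-left minors. -/
noncomputable def shiftDown (k : ℕ) : GlProd k →ₗ[ℂ] GlProd k :=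
  LinearMap.pi (Fin.lastCases
    (motive := fun j : Fin (k + 1) => GlProd k →ₗ[ℂ] Matrix (Fin (j + 1)) (Fin (j + 1)) ℂ) 0
    (fun i : Fin k => upperLeftLin (Nat.le_succ _) ∘ₗ LinearMap.proj i.succ))

/-- The constant part of `leftPart`. -/
noncomputable def shiftIdem (k : ℕ) : GlProd k :=
  Fin.cases (motive := fun j : Fin (k + 1) => Matrix (Fin (j + 1)) (Fin (j + 1)) ℂ) 1
    (fun _ : Fin k => cornerIdem _)

theorem shiftUp_zero (a : GlProd k) : shiftUp k a 0 = 0 := rfl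

theorem shiftUp_succ (a : GlProd k) (i : Fin k) :
    shiftUp k a i.succ = cornerLin (i + 1) (a i.castSucc) := rfl

theorem shiftDown_last (a : GlProd k) : shiftDown k a (Fin.last k) = 0 := by
  simp [shiftDown]

theorem shiftDown_castSucc (a : GlProd k) (i : Fin k) :
    shiftDown k a i.castSucc = upperLeft (Nat.le_succ (i + 1)) (a i.succ) := by
  simp only [shiftDown, LinearMap.pi_apply, Fin.lastCases_castSucc]
  rfl

theorem leftPart_zero (h : (GlProd k)ˣ) : (leftPart h : GlProd k) 0 = 1 := rfl

theorem leftPart_succ (h : (GlProd k)ˣ) (i : Fin k) :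
    (leftPart h : GlProd k) i.succ = cornerHom (i + 1) ((h : GlProd k) i.castSucc) := rfl

theorem leftPart_eq (h : (GlProd k)ˣ) :
    (leftPart h : GlProd k) = shiftUp k h + shiftIdem k := by
  funext j
  cases j using Fin.cases with
  | zero => rw [leftPart_zero, Pi.add_apply, shiftUp_zero, zero_add]; rfl
  | succ i => rw [leftPart_succ, cornerHom_eq]; rfl

theorem leftPart_one : leftPart (1 : (GlProd k)ˣ) = 1 := by
  ext1
  funext j
  cases j using Fin.cases with
  | zero => rfl
  | succ i => rw [leftPart_succ]; exact map_one _

theorem leftPart_mul (g h : (GlProd k)ˣ) : leftPart (g * h) = leftPart g * leftPart h := by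
  ext1
  funext j
  cases j using Fin.cases with
  | zero => exact (one_mul _).symm
  | succ i =>
    rw [leftPart_succ, Units.val_mul, Units.val_mul, Pi.mul_apply, Pi.mul_apply, map_mul,
      leftPart_succ, leftPart_succ]

theorem leftPart_inv (h : (GlProd k)ˣ) : leftPart h⁻¹ = (leftPart h)⁻¹ := by
  rw [eq_inv_iff_mul_eq_one, ← leftPart_mul, inv_mul_cancel, leftPart_one]

theorem trProd_shiftUp_mul (a b : GlProd k) :
    trProd k (shiftUp k a * b) = trProd k (a * shiftDown k b) := by
  rw [trProd_apply, trProd_apply, Fin.sum_univ_succ, Fin.sum_univ_castSucc]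
  simp only [Pi.mul_apply, shiftUp_zero, shiftDown_last, shiftUp_succ, shiftDown_castSucc, zero_mul,
    mul_zero, Matrix.trace_zero, zero_add, add_zero]
  exact Finset.sum_congr rfl fun i _ => trace_cornerLin_mul _ _

theorem shiftDown_leftPart_mul (h : (GlProd k)ˣ) (b : GlProd k) :
    shiftDown k (leftPart h * b) = h * shiftDown k b := by
  funext j
  cases j using Fin.lastCases with
  | last => rw [Pi.mul_apply, shiftDown_last, shiftDown_last, mul_zero]
  | cast i =>
    rw [Pi.mul_apply, shiftDown_castSucc, shiftDown_castSucc, Pi.mul_apply, leftPart_succ]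
    exact upperLeft_cornerHom_mul _ _

theorem shiftDown_mul_leftPart (h : (GlProd k)ˣ) (b : GlProd k) :
    shiftDown k (b * leftPart h) = shiftDown k b * h := by
  funext j
  cases j using Fin.lastCases with
  | last => rw [Pi.mul_apply, shiftDown_last, shiftDown_last, zero_mul]
  | cast i =>
    rw [Pi.mul_apply, shiftDown_castSucc, shiftDown_castSucc, Pi.mul_apply, leftPart_succ]
    exact upperLeft_mul_cornerHom _ _

/-- Component `j + 1` depends only on component `j`, and component `0` vanishes. This gives
uniqueness of the gauge. -/
theorem eq_zero_of_eq_shiftUp_mul {x g : GlProd k} (h : x = shiftUp k x * g) : x = 0 := by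
  funext j
  induction j using Fin.induction with
  | zero => rw [h, Pi.mul_apply, shiftUp_zero, zero_mul]; rfl
  | succ i ih => rw [h, Pi.mul_apply, shiftUp_succ, ih, Pi.zero_apply, map_zero, zero_mul]; rfl

/-- The same argument downwards from the last component. It serves twice: with general `g` for the
regularity of the moment map, and with `g = 1` for the uniqueness of `B` on the slice. -/
theorem eq_zero_of_conj_eq_shiftDown {b : GlProd k} {g : (GlProd k)ˣ}
    (h : (g⁻¹ : (GlProd k)ˣ) * b * g = shiftDown k b) : b = 0 := by
  have h' : b = g * shiftDown k b * (g⁻¹ : (GlProd k)ˣ) := by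
    rw [← h]; simp [mul_assoc]
  funext j
  induction j using Fin.reverseInduction with
  | last => rw [h', Pi.mul_apply, Pi.mul_apply, shiftDown_last, mul_zero, zero_mul]; rfl
  | cast i ih =>
    rw [h', Pi.mul_apply, Pi.mul_apply, shiftDown_castSucc, ih]
    rw [show upperLeft (Nat.le_succ ((i : ℕ) + 1)) ((0 : GlProd k) i.succ) = 0 from rfl, mul_zero,
      zero_mul]
    rfl

/-- The inclusion of the last factor. -/
noncomputable def lastIncl (k : ℕ) : Matrix (Fin (k + 1)) (Fin (k + 1)) ℂ →ₗ[ℂ] GlProd k :=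
  LinearMap.single ℂ (fun j : Fin (k + 1) => Matrix (Fin (j + 1)) (Fin (j + 1)) ℂ) (Fin.last k)

theorem lastIncl_last (a : Matrix (Fin (k + 1)) (Fin (k + 1)) ℂ) :
    lastIncl k a (Fin.last k) = a := by
  simp [lastIncl]

theorem lastIncl_castSucc (a : Matrix (Fin (k + 1)) (Fin (k + 1)) ℂ) (i : Fin k) :
    lastIncl k a i.castSucc = 0 :=
  Pi.single_eq_of_ne (Fin.castSucc_lt_last i).ne _

/-- The projection to the last factor. -/
noncomputable def lastProj (k : ℕ) : GlProd k →ₗ[ℂ] Matrix (Fin (k + 1)) (Fin (k + 1)) ℂ :=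
  LinearMap.proj (Fin.last k)

theorem mul_lastIncl_mul (a c : GlProd k) (b : Matrix (Fin (k + 1)) (Fin (k + 1)) ℂ) :
    a * lastIncl k b * c = lastIncl k (lastProj k a * b * lastProj k c) := by
  funext j
  cases j using Fin.lastCases with
  | last => rw [Pi.mul_apply, Pi.mul_apply, lastIncl_last, lastIncl_last]; rfl
  | cast i => rw [Pi.mul_apply, Pi.mul_apply, lastIncl_castSucc, lastIncl_castSucc, mul_zero,
      zero_mul]

theorem trProd_lastIncl_mul (a : Matrix (Fin (k + 1)) (Fin (k + 1)) ℂ) (b : GlProd k) :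
    trProd k (lastIncl k a * b) = (a * lastProj k b).trace := by
  rw [trProd_mul_comm, Matrix.trace_mul_comm]
  exact trProd_mul_single b (Fin.last k) a

/-- Replaces the definition by cases with linear maps, so that differentiation and equivariance can
be treated in the whole algebra at once. -/
theorem extMoment_eq {M : Type*} (μ : M → Matrix (Fin (k + 1)) (Fin (k + 1)) ℂ)
    (x : ExtSpace k M) :
    extMoment μ x = shiftDown k x.2.2 + lastIncl k (μ x.1)
      - (x.2.1⁻¹ : (GlProd k)ˣ) * x.2.2 * x.2.1 := by
  unfold extMoment
  congr 1
  funext j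
  cases j using Fin.lastCases with
  | last => rw [Pi.add_apply, shiftDown_last, lastIncl_last, zero_add, Fin.lastCases_last]
  | cast i => 
    rw [Pi.add_apply, shiftDown_castSucc, lastIncl_castSucc, add_zero, Fin.lastCases_castSucc]

/-- The sequence of upper-left minors of a matrix. -/
noncomputable def minors (a : Matrix (Fin (k + 1)) (Fin (k + 1)) ℂ) : GlProd k :=
  fun m => upperLeft m.2 a

theorem minors_eq (a : Matrix (Fin (k + 1)) (Fin (k + 1)) ℂ) :
    minors a = shiftDown k (minors a) + lastIncl k a := by
  funext j
  cases j using Fin.lastCases with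
  | last => rw [Pi.add_apply, shiftDown_last, lastIncl_last, zero_add]; rfl
  | cast i => rw [Pi.add_apply, shiftDown_castSucc, lastIncl_castSucc, add_zero]; rfl

theorem eq_minors {a : Matrix (Fin (k + 1)) (Fin (k + 1)) ℂ} {b : GlProd k}
    (h : b = shiftDown k b + lastIncl k a) : b = minors a := by
  have h1 : b - minors a = shiftDown k (b - minors a) := by
    conv_lhs => rw [h, minors_eq]
    rw [map_sub]; abel
  rw [← sub_eq_zero]
  refine eq_zero_of_conj_eq_shiftDown (g := 1) ?_
  simpa using h1

/-- The factor `GL(i + 1)` of `GL(1) × ⋯ × GL(k + 1)`, for `0 < i`. -/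
noncomputable def succUnit (g : (GlProd k)ˣ) (i : Fin k) : GL (Fin (i + 1 + 1)) ℂ :=
  MulEquiv.piUnits g i.succ

/-- The unique element `h` of `GL(1) × ⋯ × GL(k + 1)` with `h = leftPart h * g`. -/
noncomputable def gaugeUnit (g : (GlProd k)ˣ) : (GlProd k)ˣ :=
  MulEquiv.piUnits.symm
    (Fin.induction (motive := fun j : Fin (k + 1) => GL (Fin (j + 1)) ℂ) (MulEquiv.piUnits g 0)
      (fun i h => corner (i + 1) h * succUnit g i))

theorem gaugeUnit_zero (g : (GlProd k)ˣ) : (gaugeUnit g : GlProd k) 0 = (g : GlProd k) 0 := rfl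

theorem gaugeUnit_succ (g : (GlProd k)ˣ) (i : Fin k) :
    (gaugeUnit g : GlProd k) i.succ
      = cornerHom (i + 1) ((gaugeUnit g : GlProd k) i.castSucc) * (succUnit g i).val := rfl

theorem gaugeUnit_eq (g : (GlProd k)ˣ) : gaugeUnit g = leftPart (gaugeUnit g) * g := by
  ext1
  funext j
  cases j using Fin.cases with
  | zero => rw [Units.val_mul, Pi.mul_apply, leftPart_zero, one_mul, gaugeUnit_zero]
  | succ i => rw [Units.val_mul, Pi.mul_apply, leftPart_succ, gaugeUnit_succ]; rfl

/-- The constant part of `leftPart` cancels in the difference of two solutions, leaving the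
homogeneous triangular system. -/
theorem eq_gaugeUnit {g h : (GlProd k)ˣ} (hg : h = leftPart h * g) : h = gaugeUnit g := by
  ext1
  rw [← sub_eq_zero]
  refine eq_zero_of_eq_shiftUp_mul (g := g) ?_
  have h1 := congrArg Units.val hg
  have h2 := congrArg Units.val (gaugeUnit_eq g)
  rw [Units.val_mul, leftPart_eq] at h1 h2
  rw [map_sub, sub_mul]
  nth_rw 1 [h1, h2]
  noncomm_ring

end GlProdAlgebra

/-! ### Derivatives of products and inverses of units -/

section UnitsCalculus

variable {A : Type*} [NormedRing A] [NormedAlgebra ℂ A]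
  {E : Type*} [NormedAddCommGroup E] [NormedSpace ℂ E]
  {H : Type*} [TopologicalSpace H] {I : ModelWithCorners ℂ E H}
  {X : Type*} [TopologicalSpace X] [ChartedSpace H X]

theorem ContMDiff.mul_algebra {f g : X → A} (hf : ContMDiff I 𝓘(ℂ, A) ω f)
    (hg : ContMDiff I 𝓘(ℂ, A) ω g) : ContMDiff I 𝓘(ℂ, A) ω (fun y => f y * g y) :=
  (contDiff_mul (𝕜 := ℂ) (𝔸 := A)).contMDiff.comp (hf.prodMk_space hg)

theorem HasMFDerivAt.mul_apply {f g : X → A} {x : X} {f' g' : TangentSpace I x →L[ℂ] A}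
    (hf : HasMFDerivAt I 𝓘(ℂ, A) f x f') (hg : HasMFDerivAt I 𝓘(ℂ, A) g x g') :
    HasMFDerivAt I 𝓘(ℂ, A) (fun y => f y * g y) x
      ((ContinuousLinearMap.mul ℂ A (f x)).comp g'
        + ((ContinuousLinearMap.mul ℂ A).flip (g x)).comp f') :=
  hf.mul' hg

theorem Units.hasMFDerivAt_val_inv [CompleteSpace A] (g : Aˣ) :
    HasMFDerivAt 𝓘(ℂ, A) 𝓘(ℂ, A) (fun g : Aˣ => ((g⁻¹ : Aˣ) : A)) g
      (-ContinuousLinearMap.mulLeftRight ℂ A ((g⁻¹ : Aˣ) : A) ((g⁻¹ : Aˣ) : A)) := by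
  have h1 := hasFDerivAt_ringInverse (𝕜 := ℂ) g
  have h2 := h1.hasMFDerivAt.comp g (Units.hasMFDerivAt_val g)
  have h3 : Ring.inverse ∘ Units.val = fun g : Aˣ => ((g⁻¹ : Aˣ) : A) := by
    funext g; exact Ring.inverse_unit g
  rw [h3] at h2
  exact h2

theorem HasMFDerivAt.units_val [CompleteSpace A] {f : X → Aˣ} {x : X}
    {f' : TangentSpace I x →L[ℂ] A} (hf : HasMFDerivAt I 𝓘(ℂ, A) f x f') :
    HasMFDerivAt I 𝓘(ℂ, A) (fun y => (f y : A)) x f' :=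
  (Units.hasMFDerivAt_val (f x)).comp x hf

theorem HasMFDerivAt.units_val_inv [CompleteSpace A] {f : X → Aˣ} {x : X}
    {f' : TangentSpace I x →L[ℂ] A} (hf : HasMFDerivAt I 𝓘(ℂ, A) f x f') :
    HasMFDerivAt I 𝓘(ℂ, A) (fun y => (((f y)⁻¹ : Aˣ) : A)) x
      ((-ContinuousLinearMap.mulLeftRight ℂ A (((f x)⁻¹ : Aˣ) : A) (((f x)⁻¹ : Aˣ) : A)) ∘L f') :=
  (Units.hasMFDerivAt_val_inv (f x)).comp x hf

end UnitsCalculus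

/-! ### Action laws and equivariance of the moment map -/

section ExtActionAlgebra

variable {k : ℕ} {M : Type*}

/-- The last component of an element of `GL(1) × ⋯ × GL(k + 1)`. -/
noncomputable def lastUnit (h : (GlProd k)ˣ) : GL (Fin (k + 1)) ℂ :=
  MulEquiv.piUnits h (Fin.last k)

theorem lastUnit_one : lastUnit (1 : (GlProd k)ˣ) = 1 := rfl

theorem lastUnit_mul (g h : (GlProd k)ˣ) : lastUnit (g * h) = lastUnit g * lastUnit h := rfl

theorem lastUnit_inv (h : (GlProd k)ˣ) : lastUnit h⁻¹ = (lastUnit h)⁻¹ := rfl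

variable [MulAction (GL (Fin (k + 1)) ℂ) M]

theorem extAct_eq (h : (GlProd k)ˣ) (x : ExtSpace k M) :
    extAct h x = (lastUnit h • x.1, (leftPart h * x.2.1 * h⁻¹,
      leftPart h * x.2.2 * ((leftPart h)⁻¹ : (GlProd k)ˣ))) :=
  rfl

theorem one_extAct (x : ExtSpace k M) : extAct 1 x = x := by
  rw [extAct_eq, leftPart_one, lastUnit_one]
  simp

theorem mul_extAct (g h : (GlProd k)ˣ) (x : ExtSpace k M) :
    extAct (g * h) x = extAct g (extAct h x) := by
  simp only [extAct_eq, leftPart_mul, lastUnit_mul, mul_smul, mul_inv_rev, Units.val_mul, mul_assoc]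

theorem extMoment_extAct {μ : M → Matrix (Fin (k + 1)) (Fin (k + 1)) ℂ}
    (hμ : ∀ (g : GL (Fin (k + 1)) ℂ) (p : M), μ (g • p) = g * μ p * (g⁻¹ : GL (Fin (k + 1)) ℂ))
    (h : (GlProd k)ˣ) (x : ExtSpace k M) :
    extMoment μ (extAct h x) = h * extMoment μ x * (h⁻¹ : (GlProd k)ˣ) := by
  have h1 : lastIncl k (μ (lastUnit h • x.1))
      = h * lastIncl k (μ x.1) * (h⁻¹ : (GlProd k)ˣ) := by
    rw [hμ, mul_lastIncl_mul]; rfl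
  have h2 : shiftDown k (leftPart h * x.2.2 * ((leftPart h)⁻¹ : (GlProd k)ˣ))
      = h * shiftDown k x.2.2 * (h⁻¹ : (GlProd k)ˣ) := by
    rw [← leftPart_inv, shiftDown_mul_leftPart, shiftDown_leftPart_mul]
  rw [extMoment_eq, extMoment_eq, extAct_eq, h1, h2]
  simp only [mul_inv_rev, inv_inv, Units.val_mul, mul_sub, sub_mul, mul_add, add_mul, mul_assoc,
    Units.inv_mul_cancel_left]

end ExtActionAlgebra

/-! ### Holomorphy of the action -/

section ExtAction

variable {k : ℕ} {E : Type*} [NormedAddCommGroup E] [NormedSpace ℂ E]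
  {M : Type*} [TopologicalSpace M] [ChartedSpace E M]

theorem contMDiff_lastUnit : ContMDiff 𝓘(ℂ, GlProd k) 𝓘(ℂ, Matrix (Fin (k + 1)) (Fin (k + 1)) ℂ) ω
    (lastUnit : (GlProd k)ˣ → GL (Fin (k + 1)) ℂ) :=
  Units.contMDiff_of_val ((lastProj k).toContinuousLinearMap.contMDiff.comp Units.contMDiff_val)

theorem hasMFDerivAt_lastUnit (h : (GlProd k)ˣ) :
    HasMFDerivAt 𝓘(ℂ, GlProd k) 𝓘(ℂ, Matrix (Fin (k + 1)) (Fin (k + 1)) ℂ)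
      (lastUnit : (GlProd k)ˣ → GL (Fin (k + 1)) ℂ) h (lastProj k).toContinuousLinearMap :=
  Units.hasMFDerivAt_of_val (contMDiff_lastUnit.mdifferentiable (by simp) h)
    ((lastProj k).toContinuousLinearMap.hasMFDerivAt.comp h (Units.hasMFDerivAt_val h))

theorem contMDiff_leftPart_val : ContMDiff 𝓘(ℂ, GlProd k) 𝓘(ℂ, GlProd k) ω
    (fun h : (GlProd k)ˣ => (leftPart h : GlProd k)) := by
  simp only [leftPart_eq]
  exact ((shiftUp k).toContinuousLinearMap.contMDiff.comp Units.contMDiff_val).add contMDiff_const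

theorem hasMFDerivAt_leftPart_val (h : (GlProd k)ˣ) :
    HasMFDerivAt 𝓘(ℂ, GlProd k) 𝓘(ℂ, GlProd k)
      (fun h : (GlProd k)ˣ => (leftPart h : GlProd k)) h (shiftUp k).toContinuousLinearMap := by
  rw [show (fun h : (GlProd k)ˣ => (leftPart h : GlProd k)) = fun h : (GlProd k)ˣ =>
    shiftUp k h + shiftIdem k from funext leftPart_eq]
  have h1 := ((shiftUp k).toContinuousLinearMap.hasMFDerivAt.comp h
    (Units.hasMFDerivAt_val h)).add (hasMFDerivAt_const (shiftIdem k) h)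
  exact h1.congr_mfderiv (add_zero _)

theorem contMDiff_leftPart : ContMDiff 𝓘(ℂ, GlProd k) 𝓘(ℂ, GlProd k) ω
    (leftPart : (GlProd k)ˣ → (GlProd k)ˣ) :=
  Units.contMDiff_of_val contMDiff_leftPart_val

variable [MulAction (GL (Fin (k + 1)) ℂ) M]

theorem contMDiff_extAct
    (hM : ContMDiff (𝓘(ℂ, Matrix (Fin (k + 1)) (Fin (k + 1)) ℂ).prod 𝓘(ℂ, E)) 𝓘(ℂ, E) ω
      (fun q : GL (Fin (k + 1)) ℂ × M => q.1 • q.2)) :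
    ContMDiff (𝓘(ℂ, GlProd k).prod (extModel k E)) (extModel k E) ω
      (fun q : (GlProd k)ˣ × ExtSpace k M => extAct q.1 q.2) := by
  have hL : ContMDiff (𝓘(ℂ, GlProd k).prod (extModel k E)) 𝓘(ℂ, GlProd k) ω
      (fun q : (GlProd k)ˣ × ExtSpace k M => leftPart q.1) :=
    contMDiff_leftPart.comp contMDiff_fst
  have hp : ContMDiff (𝓘(ℂ, GlProd k).prod (extModel k E)) 𝓘(ℂ, E) ω
      (fun q : (GlProd k)ˣ × ExtSpace k M => q.2.1) :=
    contMDiff_fst.comp contMDiff_snd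
  have hg : ContMDiff (𝓘(ℂ, GlProd k).prod (extModel k E)) 𝓘(ℂ, GlProd k) ω
      (fun q : (GlProd k)ˣ × ExtSpace k M => q.2.2.1) :=
    contMDiff_fst.comp (contMDiff_snd.comp contMDiff_snd)
  have hB : ContMDiff (𝓘(ℂ, GlProd k).prod (extModel k E)) 𝓘(ℂ, GlProd k) ω
      (fun q : (GlProd k)ˣ × ExtSpace k M => q.2.2.2) :=
    contMDiff_snd.comp (contMDiff_snd.comp contMDiff_snd)
  refine ContMDiff.prodMk (hM.comp ((contMDiff_lastUnit.comp contMDiff_fst).prodMk hp))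
    (ContMDiff.prodMk ((hL.mul hg).mul contMDiff_fst.inv) ?_)
  exact ((Units.contMDiff_val.comp hL).mul_algebra hB).mul_algebra (Units.contMDiff_val.comp hL.inv)

end ExtAction

/-! ### Derivatives of the action and of the moment map; the Hamiltonian property -/

section ExtHamiltonian

variable {k : ℕ} {E : Type*} [NormedAddCommGroup E] [NormedSpace ℂ E]
  {M : Type*} [TopologicalSpace M] [ChartedSpace E M]

theorem hasMFDerivAt_extSpace_fst (x : ExtSpace k M) :
    HasMFDerivAt (extModel k E) 𝓘(ℂ, E) (fun y : ExtSpace k M => y.1) x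
      (ContinuousLinearMap.fst ℂ E (GlProd k × GlProd k)) :=
  hasMFDerivAt_fst x

theorem hasMFDerivAt_extSpace_group (x : ExtSpace k M) :
    HasMFDerivAt (extModel k E) 𝓘(ℂ, GlProd k) (fun y : ExtSpace k M => y.2.1) x
      (ContinuousLinearMap.fst ℂ (GlProd k) (GlProd k)
        ∘L ContinuousLinearMap.snd ℂ E (GlProd k × GlProd k)) :=
  HasMFDerivAt.comp x (hasMFDerivAt_fst x.2) (hasMFDerivAt_snd x)

theorem hasMFDerivAt_extSpace_group_val (x : ExtSpace k M) :
    HasMFDerivAt (extModel k E) 𝓘(ℂ, GlProd k) (fun y : ExtSpace k M => (y.2.1 : GlProd k)) x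
      (ContinuousLinearMap.fst ℂ (GlProd k) (GlProd k)
        ∘L ContinuousLinearMap.snd ℂ E (GlProd k × GlProd k)) :=
  (hasMFDerivAt_extSpace_group x).units_val

theorem hasMFDerivAt_extSpace_snd (x : ExtSpace k M) :
    HasMFDerivAt (extModel k E) 𝓘(ℂ, GlProd k) (fun y : ExtSpace k M => y.2.2) x
      (ContinuousLinearMap.snd ℂ (GlProd k) (GlProd k)
        ∘L ContinuousLinearMap.snd ℂ E (GlProd k × GlProd k)) :=
  HasMFDerivAt.comp x (hasMFDerivAt_snd x.2) (hasMFDerivAt_snd x)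

theorem contMDiff_extSpace_group :
    ContMDiff (extModel k E) 𝓘(ℂ, GlProd k) ω (fun y : ExtSpace k M => y.2.1) :=
  contMDiff_fst.comp contMDiff_snd

theorem contMDiff_extSpace_snd :
    ContMDiff (extModel k E) 𝓘(ℂ, GlProd k) ω (fun y : ExtSpace k M => y.2.2) :=
  contMDiff_snd.comp contMDiff_snd

/-- The derivative of the moment map of `extAct`. -/
theorem hasMFDerivAt_extMoment {μ : M → Matrix (Fin (k + 1)) (Fin (k + 1)) ℂ} (x : ExtSpace k M)
    {μ' : E →L[ℂ] Matrix (Fin (k + 1)) (Fin (k + 1)) ℂ}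
    (hμ : HasMFDerivAt 𝓘(ℂ, E) 𝓘(ℂ, Matrix (Fin (k + 1)) (Fin (k + 1)) ℂ) μ x.1 μ') :
    ∃ D : E × GlProd k × GlProd k →L[ℂ] GlProd k,
      HasMFDerivAt (extModel k E) 𝓘(ℂ, GlProd k) (extMoment μ) x D ∧
      ∀ v, D v = shiftDown k v.2.2 + lastIncl k (μ' v.1)
        - (-((x.2.1⁻¹ : (GlProd k)ˣ) * v.2.1 * (x.2.1⁻¹ : (GlProd k)ˣ) * x.2.2 * x.2.1)
          + (x.2.1⁻¹ : (GlProd k)ˣ) * v.2.2 * x.2.1 + (x.2.1⁻¹ : (GlProd k)ˣ) * x.2.2 * v.2.1) := by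
  have h1 := HasMFDerivAt.comp x (shiftDown k).toContinuousLinearMap.hasMFDerivAt
    (hasMFDerivAt_extSpace_snd (E := E) x)
  have h2 := HasMFDerivAt.comp x (lastIncl k).toContinuousLinearMap.hasMFDerivAt
    (HasMFDerivAt.comp x hμ (hasMFDerivAt_extSpace_fst x))
  have h3 := (hasMFDerivAt_extSpace_group (E := E) x).units_val_inv
  have h4 := (h3.mul_apply (hasMFDerivAt_extSpace_snd x)).mul_apply
    (hasMFDerivAt_extSpace_group_val x)
  have h5 := (h1.add h2).sub h4
  refine ⟨_, h5.congr_of_eventuallyEq (Filter.Eventually.of_forall fun y => extMoment_eq μ y),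
    fun v => ?_⟩
  change shiftDown k v.2.2 + lastIncl k (μ' v.1) - ((x.2.1⁻¹ : (GlProd k)ˣ) * x.2.2 * v.2.1
    + ((x.2.1⁻¹ : (GlProd k)ˣ) * v.2.2
      + -((x.2.1⁻¹ : (GlProd k)ˣ) * v.2.1 * (x.2.1⁻¹ : (GlProd k)ˣ)) * x.2.2) * x.2.1) = _
  noncomm_ring

theorem surjective_mfderiv_extMoment {μ : M → Matrix (Fin (k + 1)) (Fin (k + 1)) ℂ}
    (x : ExtSpace k M)
    (hμ : MDifferentiableAt 𝓘(ℂ, E) 𝓘(ℂ, Matrix (Fin (k + 1)) (Fin (k + 1)) ℂ) μ x.1) :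
    Function.Surjective (mfderiv (extModel k E) 𝓘(ℂ, GlProd k) (extMoment μ) x) := by
  obtain ⟨μ', hμ'⟩ : ∃ μ' : E →L[ℂ] Matrix (Fin (k + 1)) (Fin (k + 1)) ℂ,
    HasMFDerivAt 𝓘(ℂ, E) 𝓘(ℂ, Matrix (Fin (k + 1)) (Fin (k + 1)) ℂ) μ x.1 μ' :=
    ⟨_, hμ.hasMFDerivAt⟩
  obtain ⟨D, hD, hDv⟩ := hasMFDerivAt_extMoment x hμ'
  rw [hD.mfderiv]
  -- `T` is the derivative in the direction of `B` alone. It is an injective endomorphism of a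
  -- finite-dimensional space, hence onto, whatever the point and `μ`.
  let T : GlProd k →ₗ[ℂ] GlProd k := shiftDown k
    - LinearMap.mulLeftRight ℂ ((((x.2.1)⁻¹ : (GlProd k)ˣ) : GlProd k), (x.2.1 : GlProd k))
  have hT (b : GlProd k) : T b = shiftDown k b - (x.2.1⁻¹ : (GlProd k)ˣ) * b * x.2.1 := rfl
  have hinj : Function.Injective T := by
    refine (injective_iff_map_eq_zero T).2 fun b hb => ?_
    rw [hT, sub_eq_zero] at hb
    exact eq_zero_of_conj_eq_shiftDown hb.symm
  intro c
  obtain ⟨b, hb⟩ := LinearMap.injective_iff_surjective.1 hinj c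
  refine ⟨((0, 0, b) : E × GlProd k × GlProd k), (hDv (0, 0, b)).trans ?_⟩
  rw [← hb, hT]
  simp

theorem contMDiff_extMoment {μ : M → Matrix (Fin (k + 1)) (Fin (k + 1)) ℂ}
    (hμ : ContMDiff 𝓘(ℂ, E) 𝓘(ℂ, Matrix (Fin (k + 1)) (Fin (k + 1)) ℂ) ω μ) :
    ContMDiff (extModel k E) 𝓘(ℂ, GlProd k) ω (extMoment (k := k) μ) := by
  have hg := contMDiff_extSpace_group (k := k) (E := E) (M := M)
  have hB := contMDiff_extSpace_snd (k := k) (E := E) (M := M)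
  have h1 := (shiftDown k).toContinuousLinearMap.contMDiff.comp hB
  have h2 := (lastIncl k).toContinuousLinearMap.contMDiff.comp
    (hμ.comp (contMDiff_fst (I := 𝓘(ℂ, E)) (J := 𝓘(ℂ, GlProd k).prod 𝓘(ℂ, GlProd k))
      (M := M) (N := (GlProd k)ˣ × GlProd k) (n := ω)))
  have h3 := ((Units.contMDiff_val.comp hg.inv).mul_algebra hB).mul_algebra
    (Units.contMDiff_val.comp hg)
  rw [show extMoment (k := k) μ = _ from funext (extMoment_eq μ)]
  exact (h1.add h2).sub h3

variable [MulAction (GL (Fin (k + 1)) ℂ) M]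

theorem hasMFDerivAt_extAct (h : (GlProd k)ˣ) (x : ExtSpace k M) {ψ : E →L[ℂ] E}
    (hψ : HasMFDerivAt 𝓘(ℂ, E) 𝓘(ℂ, E) (fun p : M => lastUnit h • p) x.1 ψ)
    (hext : MDifferentiableAt (extModel k E) (extModel k E) (extAct h) x) :
    HasMFDerivAt (extModel k E) (extModel k E) (extAct h) x
      ((ψ ∘L ContinuousLinearMap.fst ℂ E (GlProd k × GlProd k)).prod
        (((ContinuousLinearMap.mulLeftRight ℂ (GlProd k) (leftPart h) (h⁻¹ : (GlProd k)ˣ)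
            ∘L ContinuousLinearMap.fst ℂ (GlProd k) (GlProd k)).prod
          (ContinuousLinearMap.mulLeftRight ℂ (GlProd k) (leftPart h)
              ((leftPart h)⁻¹ : (GlProd k)ˣ)
            ∘L ContinuousLinearMap.snd ℂ (GlProd k) (GlProd k)))
          ∘L ContinuousLinearMap.snd ℂ E (GlProd k × GlProd k))) := by
  have h1 := HasMFDerivAt.comp x hψ (hasMFDerivAt_extSpace_fst x)
  have h2 := HasMFDerivAt.comp x (ContinuousLinearMap.mulLeftRight ℂ (GlProd k) (leftPart h)
    (h⁻¹ : (GlProd k)ˣ)).hasMFDerivAt (hasMFDerivAt_extSpace_group_val (E := E) x)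
  have h3 := HasMFDerivAt.comp x (ContinuousLinearMap.mulLeftRight ℂ (GlProd k) (leftPart h)
    ((leftPart h)⁻¹ : (GlProd k)ˣ)).hasMFDerivAt (hasMFDerivAt_extSpace_snd (E := E) x)
  have h2' := Units.hasMFDerivAt_of_val (f := fun y : ExtSpace k M => leftPart h * y.2.1 * h⁻¹)
    (hext.snd.fst) h2
  exact h1.prodMk (h2'.prodMk h3)

/-- The derivative at the identity of the orbit maps of `extAct`. -/
theorem hasMFDerivAt_extAct_orbit (x : ExtSpace k M)
    {ψ : Matrix (Fin (k + 1)) (Fin (k + 1)) ℂ →L[ℂ] E}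
    (hψ : HasMFDerivAt 𝓘(ℂ, Matrix (Fin (k + 1)) (Fin (k + 1)) ℂ) 𝓘(ℂ, E)
      (fun g : GL (Fin (k + 1)) ℂ => g • x.1) 1 ψ)
    (hext : MDifferentiableAt 𝓘(ℂ, GlProd k) (extModel k E)
      (fun h : (GlProd k)ˣ => extAct h x) 1) :
    ∃ D : GlProd k →L[ℂ] E × GlProd k × GlProd k,
      HasMFDerivAt 𝓘(ℂ, GlProd k) (extModel k E) (fun h : (GlProd k)ˣ => extAct h x) 1 D ∧
      ∀ ξ, D ξ = (ψ (lastProj k ξ), shiftUp k ξ * x.2.1 - x.2.1 * ξ,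
        shiftUp k ξ * x.2.2 - x.2.2 * shiftUp k ξ) := by
  have h1 := HasMFDerivAt.comp (g := fun g : GL (Fin (k + 1)) ℂ => g • x.1) (1 : (GlProd k)ˣ) hψ
    (hasMFDerivAt_lastUnit 1)
  have hL := hasMFDerivAt_leftPart_val (1 : (GlProd k)ˣ)
  have hL' := (Units.hasMFDerivAt_of_val (f := (leftPart : (GlProd k)ˣ → (GlProd k)ˣ))
    (contMDiff_leftPart.mdifferentiable (by simp) _) hL).units_val_inv
  have h2 := (hL.mul_apply (hasMFDerivAt_const (x.2.1 : GlProd k) 1)).mul_apply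
    (Units.hasMFDerivAt_val_inv (1 : (GlProd k)ˣ))
  have h2' := Units.hasMFDerivAt_of_val (f := fun h : (GlProd k)ˣ => leftPart h * x.2.1 * h⁻¹)
    hext.snd.fst h2
  have h3 := (hL.mul_apply (hasMFDerivAt_const x.2.2 1)).mul_apply hL'
  refine ⟨_, h1.prodMk (h2'.prodMk h3), fun ξ => ?_⟩
  refine Prod.ext rfl (Prod.ext ?_ ?_)
  · change (leftPart 1 : (GlProd k)ˣ) * x.2.1 * -(((1 : (GlProd k)ˣ)⁻¹ : (GlProd k)ˣ) * ξ
      * ((1 : (GlProd k)ˣ)⁻¹ : (GlProd k)ˣ))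
      + ((leftPart 1 : (GlProd k)ˣ) * (0 : GlProd k) + shiftUp k ξ * x.2.1)
        * ((1 : (GlProd k)ˣ)⁻¹ : (GlProd k)ˣ) = shiftUp k ξ * x.2.1 - x.2.1 * ξ
    rw [leftPart_one, inv_one, Units.val_one]
    noncomm_ring
  · change (leftPart 1 : (GlProd k)ˣ) * x.2.2 * -(((leftPart 1)⁻¹ : (GlProd k)ˣ) * shiftUp k ξ
      * ((leftPart 1)⁻¹ : (GlProd k)ˣ))
      + ((leftPart 1 : (GlProd k)ˣ) * (0 : GlProd k) + shiftUp k ξ * x.2.2)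
        * ((leftPart 1)⁻¹ : (GlProd k)ˣ) = shiftUp k ξ * x.2.2 - x.2.2 * shiftUp k ξ
    rw [leftPart_one, inv_one, Units.val_one]
    noncomm_ring

theorem trProd_conj (g : (GlProd k)ˣ) (a : GlProd k) :
    trProd k (g * a * (g⁻¹ : (GlProd k)ˣ)) = trProd k a := by
  rw [trProd_mul_comm, ← mul_assoc, Units.inv_mul, one_mul]

/-- In the right-invariant trivialization `h` drops out and `l` conjugates all of `ρ`, `b` and `B`,
which the trace does not see. -/
theorem cotangentBilin_invariant (l h g : (GlProd k)ˣ) (B : GlProd k) (v w : GlProd k × GlProd k) :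
    cotangentBilin (l * g * h⁻¹) (l * B * (l⁻¹ : (GlProd k)ˣ))
        (l * v.1 * (h⁻¹ : (GlProd k)ˣ), l * v.2 * (l⁻¹ : (GlProd k)ˣ))
        (l * w.1 * (h⁻¹ : (GlProd k)ˣ), l * w.2 * (l⁻¹ : (GlProd k)ˣ))
      = cotangentBilin g B v w := by
  rw [cotangentBilin_apply, cotangentBilin_apply]
  refine Eq.trans ?_ (trProd_conj l _)
  congr 1
  simp only [Ring.lie_def, mul_inv_rev, inv_inv, Units.val_mul, mul_sub, sub_mul, mul_assoc,
    Units.inv_mul_cancel_left]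

/-- The two sides differ by the traces of four commutators, listed in `h0`. -/
theorem trProd_orbit_aux (a b c p B : GlProd k) :
    trProd k ((a - c) * b - p * (a * B - B * a) - B * ⁅a - c, p⁆)
      = trProd k (a * b) - trProd k ((B * p - p * B + b) * c) := by
  have h (x y : GlProd k) : trProd k (x * y - y * x) = 0 := by
    rw [map_sub, trProd_mul_comm, sub_self]
  have h0 : trProd k ((b * c - c * b) - ((p * a) * B - B * (p * a)) + (p * (B * a) - (B * a) * p)
      + ((B * c) * p - p * (B * c))) = 0 := by
    rw [map_add, map_add, map_sub, h, h, h, h]; simp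
  rw [← map_sub, ← sub_eq_zero, ← map_sub, ← h0]
  congr 1
  rw [Ring.lie_def]
  noncomm_ring

/-- This is the moment map identity on the cotangent factors. The substitutions `p = u g⁻¹` and `c =
g ξ g⁻¹` conjugate `g` away, and adjointness of the two shifts handles the left action. -/
theorem cotangentBilin_orbit (g : (GlProd k)ˣ) (B ξ : GlProd k) (v : GlProd k × GlProd k) :
    cotangentBilin g B (shiftUp k ξ * g - g * ξ, shiftUp k ξ * B - B * shiftUp k ξ) v
      = trProd k ((shiftDown k v.2 - (-((g⁻¹ : (GlProd k)ˣ) * v.1 * (g⁻¹ : (GlProd k)ˣ) * B * g)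
          + (g⁻¹ : (GlProd k)ˣ) * v.2 * g + (g⁻¹ : (GlProd k)ˣ) * B * v.1)) * ξ) := by
  rw [cotangentBilin_apply, sub_mul (shiftDown k v.2), map_sub (trProd k) (shiftDown k v.2 * ξ),
    trProd_mul_comm (shiftDown k v.2), ← trProd_shiftUp_mul]
  obtain ⟨u, b⟩ := v
  simp only
  generalize shiftUp k ξ = a
  obtain ⟨p, hp⟩ : ∃ p, p = u * (g⁻¹ : (GlProd k)ˣ) := ⟨_, rfl⟩
  obtain rfl : u = p * g := by rw [hp]; simp
  have e1 : ((g⁻¹ : (GlProd k)ˣ) : GlProd k) * (p * g) * (g⁻¹ : (GlProd k)ˣ) * B * g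
      = (g⁻¹ : (GlProd k)ˣ) * (p * B) * g := by
    simp [mul_assoc]
  obtain ⟨c, hc⟩ : ∃ c, c = g * ξ * (g⁻¹ : (GlProd k)ˣ) := ⟨_, rfl⟩
  obtain rfl : ξ = (g⁻¹ : (GlProd k)ˣ) * c * g := by rw [hc]; simp [mul_assoc]
  have e2 (q : GlProd k) : trProd k ((g⁻¹ : (GlProd k)ˣ) * q * g * ((g⁻¹ : (GlProd k)ˣ) * c * g))
      = trProd k (q * c) := by
    have := trProd_conj g⁻¹ (q * c)
    rw [inv_inv] at this
    rw [← this]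
    simp [mul_assoc]
  have e3 : -((g⁻¹ : (GlProd k)ˣ) * (p * g) * (g⁻¹ : (GlProd k)ˣ) * B * g : GlProd k)
      + (g⁻¹ : (GlProd k)ˣ) * b * g + (g⁻¹ : (GlProd k)ˣ) * B * (p * g)
      = (g⁻¹ : (GlProd k)ˣ) * (B * p - p * B + b) * g := by
    rw [e1]; noncomm_ring
  have e4 : (a * g - g * ((g⁻¹ : (GlProd k)ˣ) * c * g)) * (g⁻¹ : (GlProd k)ˣ) = a - c := by
    simp [mul_assoc, sub_mul]
  rw [e3, e2, e4, Units.mul_inv_cancel_right]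
  exact trProd_orbit_aux a b c p B

/-- The moment identity is the sum of that of `μ`, entering through the last factor, and of
`cotangentBilin_orbit`. -/
theorem isHamiltonianAction_extAct {σ : TwoForm 𝓘(ℂ, E) M}
    {μ : M → Matrix (Fin (k + 1)) (Fin (k + 1)) ℂ}
    (hμ : IsHamiltonianAction (Matrix.traceLinearMap (Fin (k + 1)) ℂ ℂ) σ
      (fun (g : GL (Fin (k + 1)) ℂ) (p : M) => g • p) μ) :
    IsHamiltonianAction (trProd k) (extForm k σ) extAct (extMoment μ) := by
  have hact := contMDiff_extAct hμ.holomorphic_act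
  have hdμ (x : ExtSpace k M) : HasMFDerivAt 𝓘(ℂ, E) 𝓘(ℂ, Matrix (Fin (k + 1)) (Fin (k + 1)) ℂ)
    μ x.1 _ := (hμ.holomorphic_moment.mdifferentiable (by simp) x.1).hasMFDerivAt
  refine ⟨one_extAct, mul_extAct, hact, fun h x v w => ?_, ?_, fun x ξ v => ?_,
    extMoment_extAct hμ.equivariant⟩
  · have h1 : MDifferentiableAt (extModel k E) (extModel k E) (extAct h : ExtSpace k M → _) x :=
      (hact.comp (contMDiff_const.prodMk contMDiff_id)).mdifferentiable (by simp) x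
    have h2 := hasMFDerivAt_extAct h x
      ((hμ.holomorphic_act_left (lastUnit h)).mdifferentiable (by simp) x.1).hasMFDerivAt h1
    rw [h2.mfderiv]
    exact congrArg₂ (· + ·) (hμ.symplectic (lastUnit h) x.1 v.1 w.1)
      (cotangentBilin_invariant (leftPart h) h x.2.1 x.2.2 v.2 w.2)
  · exact contMDiff_extMoment hμ.holomorphic_moment
  · obtain ⟨D, hD, hDv⟩ := hasMFDerivAt_extAct_orbit x
      ((hμ.holomorphic_act_right x.1).mdifferentiable (by simp) 1).hasMFDerivAt
      ((hact.comp (contMDiff_id.prodMk contMDiff_const)).mdifferentiable (by simp) 1)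
    obtain ⟨D', hD', hDv'⟩ := hasMFDerivAt_extMoment x (hdμ x)
    have h1 := HasMFDerivAt.comp x
      ((trProd k ∘ₗ LinearMap.mulRight ℂ ξ).toContinuousLinearMap.hasMFDerivAt) hD'
    have h2 := (HasMFDerivAt.comp x.1 ((Matrix.traceLinearMap (Fin (k + 1)) ℂ ℂ
      ∘ₗ LinearMap.mulRight ℂ (lastProj k ξ)).toContinuousLinearMap.hasMFDerivAt) (hdμ x)).mfderiv
    have h3 := hμ.moment x.1 (lastProj k ξ) v.1
    have h4 := cotangentBilin_orbit x.2.1 x.2.2 ξ v.2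
    rw [hD.mfderiv]
    refine Eq.trans ?_ (DFunLike.congr_fun h1.mfderiv v).symm
    have h5 := h3.trans (DFunLike.congr_fun h2 v.1)
    have h6 : extForm k σ x (D ξ) v = σ x.1 (D ξ).1 v.1
      + cotangentBilin x.2.1 x.2.2 (D ξ).2 v.2 := extForm_apply σ x (D ξ) v
    rw [hDv ξ] at h6
    rw [h4] at h6
    refine (congrArg (fun u => extForm k σ x u v) (hDv ξ)).trans (h6.trans ?_)
    refine (congrArg₂ (· + ·) h5 rfl).trans ?_
    refine Eq.trans ?_ (congrArg (fun u => trProd k (u * ξ)) (hDv' v)).symm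
    simp only [add_sub_right_comm, add_mul _ (lastIncl k _), map_add]
    refine (add_comm (G := ℂ) _ _).trans ?_
    exact congrArg₂ (· + ·) rfl (trProd_lastIncl_mul _ ξ).symm

end ExtHamiltonian

/-! ### The flows of the Gelfand-Zeitlin Hamiltonians -/

section TracePowers

variable {A : Type*} [NormedRing A] [NormedAlgebra ℂ A]

/-- Under `τ` the `n + 1` terms of the noncommutative Leibniz rule all become `τ (x ^ n * b)` by
cyclicity. -/
theorem hasFDerivAt_trace_pow (τ : A →L[ℂ] ℂ) (hτ : ∀ a b, τ (a * b) = τ (b * a)) (n : ℕ) (x : A) :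
    HasFDerivAt (fun y => τ (y ^ (n + 1)))
      (((n : ℂ) + 1) • (τ ∘L ContinuousLinearMap.mul ℂ A (x ^ n))) x := by
  refine (τ.hasFDerivAt.comp x (hasFDerivAt_pow' (𝕜 := ℂ) (n + 1))).congr_fderiv ?_
  ext b
  simp only [ContinuousLinearMap.comp_apply, sum_apply, map_sum,
    smul_apply, ContinuousLinearMap.id_apply, MulOpposite.smul_eq_mul_unop,
    MulOpposite.unop_op, smul_eq_mul, ContinuousLinearMap.mul_apply']
  have h : ∀ i ∈ Finset.range (n + 1), τ (x ^ ((n + 1).pred - i) * b * x ^ i) = τ (x ^ n * b) := by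
    intro i hi
    have hi' : i + ((n + 1).pred - i) = n := by
      have := Finset.mem_range.1 hi
      simp only [Nat.pred_succ]
      omega
    rw [hτ, ← mul_assoc, ← pow_add, hi']
  rw [Finset.sum_congr rfl h, Finset.sum_const, Finset.card_range, nsmul_eq_mul]
  push_cast
  ring

theorem ContMDiff.normedSpace_exp [CompleteSpace A] {E : Type*} [NormedAddCommGroup E]
    [NormedSpace ℂ E] {H : Type*} [TopologicalSpace H] {I : ModelWithCorners ℂ E H}
    {X : Type*} [TopologicalSpace X] [ChartedSpace H X] {f : X → A}
    (hf : ContMDiff I 𝓘(ℂ, A) ω f) :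
    ContMDiff I 𝓘(ℂ, A) ω (fun y => NormedSpace.exp (f y)) :=
  (contDiff_iff_contDiffAt.2 fun a =>
    (NormedSpace.exp_analytic (𝕂 := ℂ) a).contDiffAt).contMDiff.comp hf

theorem ContDiff.contMDiff_comp₂ {F₁ F₂ F : Type*} [NormedAddCommGroup F₁] [NormedSpace ℂ F₁]
    [NormedAddCommGroup F₂] [NormedSpace ℂ F₂] [NormedAddCommGroup F] [NormedSpace ℂ F]
    {E : Type*} [NormedAddCommGroup E]
    [NormedSpace ℂ E] {H : Type*} [TopologicalSpace H] {I : ModelWithCorners ℂ E H}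
    {X : Type*} [TopologicalSpace X] [ChartedSpace H X] {G : F₁ → F₂ → F}
    (hG : ContDiff ℂ ω (fun q : F₁ × F₂ => G q.1 q.2)) {f : X → F₁} {g : X → F₂}
    (hf : ContMDiff I 𝓘(ℂ, F₁) ω f) (hg : ContMDiff I 𝓘(ℂ, F₂) ω g) :
    ContMDiff I 𝓘(ℂ, F) ω (fun y => G (f y) (g y)) :=
  hG.contMDiff.comp (hf.prodMk_space hg)

end TracePowers

/-! ### The generators of the flows, their exponentials, and the Hamiltonian property -/

section Flows

variable {k : ℕ}

/-- The generator of the flow `gzAct`. -/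
noncomputable def gzGen (t : GZIndex k → ℂ) (B : GlProd k) : GlProd k :=
  fun m : Fin (k + 1) => ∑ i : Fin (m + 1), (((i : ℕ) + 1 : ℂ) * t ⟨m, i⟩) • B m ^ (i : ℕ)

theorem gzGen_apply (t : GZIndex k → ℂ) (B : GlProd k) (m : Fin (k + 1)) :
    gzGen t B m = ∑ i : Fin (m + 1), (((i : ℕ) + 1 : ℂ) * t ⟨m, i⟩) • B m ^ (i : ℕ) :=
  rfl

theorem gzGen_add (s t : GZIndex k → ℂ) (B : GlProd k) :
    gzGen (s + t) B = gzGen s B + gzGen t B := by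
  funext m
  rw [Pi.add_apply, gzGen_apply, gzGen_apply, gzGen_apply, ← Finset.sum_add_distrib]
  simp only [Pi.add_apply, mul_add, add_smul]

theorem gzGen_smul (z : ℂ) (t : GZIndex k → ℂ) (B : GlProd k) :
    gzGen (z • t) B = z • gzGen t B := by
  funext m
  rw [Pi.smul_apply, gzGen_apply, gzGen_apply, Finset.smul_sum]
  refine Finset.sum_congr rfl fun i _ => ?_
  rw [smul_smul, Pi.smul_apply, smul_eq_mul]
  ring_nf

theorem gzGen_zero (B : GlProd k) : gzGen 0 B = 0 := by
  have := gzGen_smul 0 0 B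
  rwa [zero_smul, zero_smul] at this

theorem commute_gzGen (t : GZIndex k → ℂ) (B : GlProd k) {C : GlProd k} (h : Commute C B) :
    Commute C (gzGen t B) := by
  funext m
  have hm : Commute (C m) (B m) := congrFun h m
  exact Commute.sum_right _ _ _ fun i _ => (hm.pow_right _).smul_right _

theorem gzGen_conj (t : GZIndex k → ℂ) (B : GlProd k) (g : (GlProd k)ˣ) :
    gzGen t (g * B * (g⁻¹ : (GlProd k)ˣ)) = g * gzGen t B * (g⁻¹ : (GlProd k)ˣ) := by
  funext m
  have h (n : ℕ) : (g * B * (g⁻¹ : (GlProd k)ˣ) : GlProd k) m ^ n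
      = (g : GlProd k) m * B m ^ n * ((g⁻¹ : (GlProd k)ˣ) : GlProd k) m :=
    Units.conj_pow (MulEquiv.piUnits g m) (B m) n
  rw [Pi.mul_apply, Pi.mul_apply, gzGen_apply, gzGen_apply, Finset.mul_sum, Finset.sum_mul]
  refine Finset.sum_congr rfl fun i _ => ?_
  rw [h, mul_smul_comm, smul_mul_assoc]

/-- The generator is the gradient of `gzHam a` with respect to the trace form. The factor `a.2 + 1`
is the exponent of the Hamiltonian, since indices start at `0`. -/
theorem trProd_gzGen_single_mul (a : GZIndex k) (B b : GlProd k) :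
    trProd k (gzGen (Pi.single a 1) B * b)
      = (((a.2 : ℕ) : ℂ) + 1) * (B a.1 ^ (a.2 : ℕ) * b a.1).trace := by
  have h : trProd k (gzGen (Pi.single a 1) B * b) = ∑ c : GZIndex k,
      ((((c.2 : ℕ) : ℂ) + 1) * (Pi.single a 1 : GZIndex k → ℂ) c)
        * (B c.1 ^ (c.2 : ℕ) * b c.1).trace := by
    rw [trProd_apply, Fintype.sum_sigma]
    refine Finset.sum_congr rfl fun m _ => ?_
    rw [Pi.mul_apply, gzGen_apply, Finset.sum_mul, Matrix.trace_sum]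
    refine Finset.sum_congr rfl fun i _ => ?_
    rw [smul_mul_assoc, Matrix.trace_smul, smul_eq_mul]
  rw [h, Finset.sum_eq_single a]
  · simp
  · intro c _ hc
    rw [Pi.single_eq_of_ne hc]; simp
  · simp

theorem expUnit_val (a : GlProd k) : (expUnit a : GlProd k) = NormedSpace.exp a := rfl

theorem expUnit_zero : expUnit (0 : GlProd k) = 1 := by
  ext1
  rw [expUnit_val, NormedSpace.exp_zero]; rfl

theorem expUnit_add {a b : GlProd k} (h : Commute a b) :
    expUnit (a + b) = expUnit a * expUnit b := by
  ext1
  rw [Units.val_mul, expUnit_val, expUnit_val, expUnit_val]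
  exact NormedSpace.exp_add_of_commute h

theorem expUnit_conj (g : (GlProd k)ˣ) (a : GlProd k) :
    expUnit (k := k) (g * a * (g⁻¹ : (GlProd k)ˣ)) = g * expUnit a * g⁻¹ := by
  ext1
  rw [Units.val_mul, Units.val_mul, expUnit_val, expUnit_val]
  exact NormedSpace.exp_units_conj g a

theorem commute_expUnit {a b : GlProd k} (h : Commute b a) : Commute b (expUnit a) := by
  rw [expUnit_val]
  exact h.exp_right

theorem gzAct_eq {M : Type*} (t : GZIndex k → ℂ) (x : ExtSpace k M) :
    gzAct t x = (x.1, (expUnit (gzGen t x.2.2) * x.2.1, x.2.2)) := rfl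

theorem gzHam_extAct {M : Type*} [MulAction (GL (Fin (k + 1)) ℂ) M] (a : GZIndex k)
    (h : (GlProd k)ˣ) (x : ExtSpace k M) :
    gzHam a (extAct h x) = gzHam a x := by
  have h1 : (leftPart h * x.2.2 * ((leftPart h)⁻¹ : (GlProd k)ˣ) : GlProd k) a.1
        ^ ((a.2 : ℕ) + 1)
      = (leftPart h : GlProd k) a.1 * x.2.2 a.1 ^ ((a.2 : ℕ) + 1)
        * (((leftPart h)⁻¹ : (GlProd k)ˣ) : GlProd k) a.1 :=
    Units.conj_pow (MulEquiv.piUnits (leftPart h) a.1) (x.2.2 a.1) _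
  have h2 : gzHam a (extAct h x) = ((leftPart h * x.2.2 * ((leftPart h)⁻¹ : (GlProd k)ˣ)
      : GlProd k) a.1 ^ ((a.2 : ℕ) + 1)).trace := rfl
  rw [h2, h1, Matrix.trace_mul_comm, ← mul_assoc, ← Pi.mul_apply, Units.inv_mul,
    Pi.one_apply, one_mul]
  rfl

/-- The exponential is taken of a polynomial in `B`, so it commutes with `B` and cancels in `g⁻¹ B
g`. -/
theorem extMoment_gzAct {M : Type*} (μ : M → Matrix (Fin (k + 1)) (Fin (k + 1)) ℂ) (t : GZIndex k → ℂ)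
    (x : ExtSpace k M) : extMoment μ (gzAct t x) = extMoment μ x := by
  have h : x.2.2 * expUnit (gzGen t x.2.2) = expUnit (gzGen t x.2.2) * x.2.2 :=
    commute_expUnit (commute_gzGen t x.2.2 (Commute.refl _))
  have h' : (((expUnit (gzGen t x.2.2) * x.2.1)⁻¹ : (GlProd k)ˣ) : GlProd k) * x.2.2
      * (expUnit (gzGen t x.2.2) * x.2.1 : (GlProd k)ˣ)
      = (x.2.1⁻¹ : (GlProd k)ˣ) * x.2.2 * x.2.1 := by
    rw [mul_inv_rev, Units.val_mul, Units.val_mul, mul_assoc, ← mul_assoc x.2.2, h, mul_assoc,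
      ← mul_assoc _ (_ * x.2.2), ← mul_assoc _ _ x.2.2, Units.inv_mul, one_mul, mul_assoc]
  rw [extMoment_eq, extMoment_eq, gzAct_eq, h']

/-- The left action conjugates `B`, hence also the generator and its exponential; the right action
does not touch them. -/
theorem gzAct_extAct {M : Type*} [MulAction (GL (Fin (k + 1)) ℂ) M] (t : GZIndex k → ℂ)
    (h : (GlProd k)ˣ) (x : ExtSpace k M) :
    gzAct t (extAct h x) = extAct h (gzAct t x) := by
  rw [gzAct_eq, extAct_eq, extAct_eq, gzAct_eq, gzGen_conj, expUnit_conj]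
  simp only [mul_assoc, inv_mul_cancel_left]

theorem contDiff_gzGen : ContDiff ℂ ω (fun q : (GZIndex k → ℂ) × GlProd k => gzGen q.1 q.2) := by
  refine contDiff_pi.2 fun m => ?_
  simp only [gzGen_apply]
  refine ContDiff.sum fun i _ => ContDiff.fun_smul ?_ ?_
  · exact contDiff_const.mul ((contDiff_apply ℂ ℂ (⟨m, i⟩ : GZIndex k)).comp contDiff_fst)
  · exact ContDiff.pow ((ContinuousLinearMap.proj (R := ℂ)
      (φ := fun j : Fin (k + 1) => Matrix (Fin (j + 1)) (Fin (j + 1)) ℂ) m).contDiff.comp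
        contDiff_snd) _

variable {E : Type*} [NormedAddCommGroup E] [NormedSpace ℂ E]
  {M : Type*} [TopologicalSpace M] [ChartedSpace E M]

theorem contMDiff_gzGen : ContMDiff (𝓘(ℂ, GZIndex k → ℂ).prod (extModel k E)) 𝓘(ℂ, GlProd k) ω
    (fun q : (GZIndex k → ℂ) × ExtSpace k M => gzGen q.1 q.2.2.2) :=
  contDiff_gzGen.contMDiff_comp₂ contMDiff_fst (contMDiff_extSpace_snd.comp contMDiff_snd)

theorem contMDiff_expUnit_gzGen :
    ContMDiff (𝓘(ℂ, GZIndex k → ℂ).prod (extModel k E)) 𝓘(ℂ, GlProd k) ω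
      (fun q : (GZIndex k → ℂ) × ExtSpace k M => expUnit (gzGen q.1 q.2.2.2)) :=
  Units.contMDiff_of_val (contMDiff_gzGen (k := k) (E := E) (M := M)).normedSpace_exp

theorem contMDiff_gzAct : ContMDiff (𝓘(ℂ, GZIndex k → ℂ).prod (extModel k E)) (extModel k E) ω
    (fun q : (GZIndex k → ℂ) × ExtSpace k M => gzAct q.1 q.2) := by
  have h := (contMDiff_expUnit_gzGen (k := k) (E := E) (M := M)).mul
    (contMDiff_extSpace_group.comp contMDiff_snd)
  exact ContMDiff.prodMk (contMDiff_fst.comp contMDiff_snd)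
    (h.prodMk (contMDiff_extSpace_snd.comp contMDiff_snd))

/-- The derivative of the Hamiltonians. -/
theorem hasMFDerivAt_gzHam (a : GZIndex k) (x : ExtSpace k M) :
    ∃ D : E × GlProd k × GlProd k →L[ℂ] ℂ,
      HasMFDerivAt (extModel k E) 𝓘(ℂ, ℂ) (gzHam a) x D ∧
      ∀ v, D v = (((a.2 : ℕ) : ℂ) + 1) * (x.2.2 a.1 ^ (a.2 : ℕ) * v.2.2 a.1).trace := by
  have h1 := hasFDerivAt_trace_pow (Matrix.traceLinearMap (Fin (a.1 + 1)) ℂ ℂ).toContinuousLinearMap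
    (fun b c => Matrix.trace_mul_comm b c) a.2 (x.2.2 a.1)
  have h2 := HasMFDerivAt.comp x (ContinuousLinearMap.proj (R := ℂ)
      (φ := fun j : Fin (k + 1) => Matrix (Fin (j + 1)) (Fin (j + 1)) ℂ) a.1).hasMFDerivAt
      (hasMFDerivAt_extSpace_snd (E := E) x)
  refine ⟨_, HasMFDerivAt.comp
    (g := fun y => (Matrix.traceLinearMap (Fin (a.1 + 1)) ℂ ℂ).toContinuousLinearMap
    (y ^ ((a.2 : ℕ) + 1))) x h1.hasMFDerivAt h2, fun v => ?_⟩
  rfl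

theorem contMDiff_gzHam (a : GZIndex k) :
    ContMDiff (extModel k E) 𝓘(ℂ, ℂ) ω (gzHam a : ExtSpace k M → ℂ) := by
  have h1 : ContDiff ℂ ω (fun B : GlProd k => Matrix.traceLinearMap (Fin (a.1 + 1)) ℂ ℂ
      (B a.1 ^ ((a.2 : ℕ) + 1))) :=
    (Matrix.traceLinearMap (Fin (a.1 + 1)) ℂ ℂ).toContinuousLinearMap.contDiff.comp
      (ContDiff.pow (ContinuousLinearMap.proj (R := ℂ)
        (φ := fun j : Fin (k + 1) => Matrix (Fin (j + 1)) (Fin (j + 1)) ℂ) a.1).contDiff _)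
  exact h1.contMDiff.comp contMDiff_extSpace_snd

/-- The velocity of the flows. -/
theorem hasMFDerivAt_gzAct_single (a : GZIndex k) (x : ExtSpace k M) :
    ∃ D : ℂ →L[ℂ] E × GlProd k × GlProd k,
      HasMFDerivAt 𝓘(ℂ, ℂ) (extModel k E) (fun z : ℂ => gzAct (Pi.single a z) x) 0 D ∧
      D 1 = (0, gzGen (Pi.single a 1) x.2.2 * x.2.1, 0) := by
  set q := gzGen (Pi.single a 1) x.2.2 with hq
  have h0 (z : ℂ) : gzGen (Pi.single a z) x.2.2 = z • q := by
    rw [hq, ← gzGen_smul, ← Pi.single_smul, smul_eq_mul, mul_one]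
  have h1 : HasDerivAt (fun z : ℂ => NormedSpace.exp (z • q) * (x.2.1 : GlProd k))
      (q * x.2.1) 0 := by
    have := (hasDerivAt_exp_smul_const q (0 : ℂ)).mul_const (x.2.1 : GlProd k)
    rwa [zero_smul, NormedSpace.exp_zero, one_mul] at this
  have hc : ContMDiff 𝓘(ℂ, ℂ) (extModel k E) ω (fun z : ℂ => gzAct (Pi.single a z) x) :=
    contMDiff_gzAct.comp ((ContDiff.contMDiff
      (contDiff_single (𝕜 := ℂ) (F' := fun _ : GZIndex k => ℂ) ω a)).prodMk contMDiff_const)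
  have hfun : (fun z : ℂ => gzAct (Pi.single a z) x)
      = fun z => (x.1, (expUnit (z • q) * x.2.1, x.2.2)) := by
    funext z
    rw [gzAct_eq, h0]
  rw [hfun] at hc ⊢
  have h2 := Units.hasMFDerivAt_of_val (f := fun z : ℂ => expUnit (z • q) * x.2.1)
    (hc.mdifferentiable (by simp) 0).snd.fst h1.hasFDerivAt.hasMFDerivAt
  refine ⟨_, (hasMFDerivAt_const x.1 0).prodMk (h2.prodMk (hasMFDerivAt_const x.2.2 0)), ?_⟩
  refine Prod.ext rfl (Prod.ext ?_ rfl)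
  exact one_smul ℂ (q * x.2.1)

theorem isHamiltonianVectorAction_gzAct (σ : TwoForm 𝓘(ℂ, E) M) :
    IsHamiltonianVectorAction (extForm k σ) gzAct gzHam := by
  refine ⟨fun x => ?_, fun s t x => ?_, contMDiff_gzAct, contMDiff_gzHam, fun a x v => ?_,
    fun a t x => rfl⟩
  · rw [gzAct_eq, gzGen_zero, expUnit_zero, one_mul]
  · rw [gzAct_eq, gzAct_eq, gzAct_eq, gzGen_add, expUnit_add, mul_assoc]
    exact commute_gzGen t _ (commute_gzGen s _ (Commute.refl _)).symm
  · obtain ⟨D, hD, hD1⟩ := hasMFDerivAt_gzAct_single (E := E) a x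
    obtain ⟨D', hD', hDv⟩ := hasMFDerivAt_gzHam (E := E) a x
    rw [hD.mfderiv, hD'.mfderiv]
    refine Eq.trans ?_ (hDv v).symm
    refine (congrArg (fun u => extForm k σ x u v) hD1).trans ?_
    refine (extForm_apply σ x (0, gzGen (Pi.single a 1) x.2.2 * x.2.1, 0) v).trans ?_
    have hq : Commute x.2.2 (gzGen (Pi.single a 1) x.2.2) :=
      commute_gzGen _ _ (Commute.refl _)
    have h0 : σ x.1 (0 : E) v.1 = 0 := LinearMap.congr_fun (map_zero (σ x.1)) v.1
    refine (congrArg₂ (· + ·) h0 rfl).trans ((zero_add _).trans ?_)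
    rw [← trProd_gzGen_single_mul, cotangentBilin_apply]
    simp only [Units.mul_inv_cancel_right, mul_zero, sub_zero]
    generalize gzGen (Pi.single a 1) x.2.2 = q at hq
    generalize v.2.1 * ((x.2.1⁻¹ : (GlProd k)ˣ) : GlProd k) = p
    -- The curvature term of the form disappears because the generator `q` commutes with `B`; what
    -- remains is the trace pairing with the gradient.
    have h1 : trProd k (x.2.2 * ⁅q, p⁆) = 0 := by
      rw [Ring.lie_def, mul_sub, map_sub, ← mul_assoc, hq.eq, mul_assoc, trProd_mul_comm q,
        mul_assoc, sub_self]
    rw [map_sub, h1, sub_zero]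

end Flows

/-! ### Compatibility of the slice action with the action on orbits -/

namespace IsGlobalSlice

variable {EX : Type*} [NormedAddCommGroup EX] [NormedSpace ℂ EX]
  {HX : Type*} [TopologicalSpace HX] {I : ModelWithCorners ℂ EX HX}
  {X : Type*} [TopologicalSpace X] [ChartedSpace HX X]
  {A : Type*} [NormedRing A] [NormedAlgebra ℂ A] [CompleteSpace A]
  {E : Type*} [NormedAddCommGroup E] [NormedSpace ℂ E]
  {M : Type*} [TopologicalSpace M] [ChartedSpace E M]
  {τ : A →ₗ[ℂ] ℂ} {σX : TwoForm I X} {act : Aˣ → X → X} {Φ : X → A}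
  {s : M → X} {r : X → M} {γ : X → Aˣ}

/-- The vector action induced on a global slice corresponds to that on the orbit space. -/
theorem proj_slice_vectorAction (hs : IsGlobalSlice (E := E) I act Φ s r γ)
    (hΦ : IsHamiltonianAction τ σX act Φ) {V : Type*} {θ : V → X → X}
    (hcomm : ∀ t h x, θ t (act h x) = act h (θ t x)) (hinv : ∀ t x, Φ (θ t x) = Φ x)
    (t : V) (z : ZeroLevel Φ) {p : M}
    (hp : (hs.orbitHomeomorph hΦ).symm p = OrbitSpace.proj act Φ z) :
    (hs.orbitHomeomorph hΦ).symm (r (θ t (s p)))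
      = OrbitSpace.proj act Φ ⟨θ t z.1, (hinv t z.1).trans z.2⟩ := by
  have h1 : p = r z.1 := (hs.orbitHomeomorph hΦ).symm_apply_eq.1 hp
  have h2 : r (θ t (s (r z.1))) = r (θ t z.1) := by
    conv_rhs => rw [← hs.act_slice z.1 z.2, hcomm,
      hs.retraction_invariant hΦ ((hinv t _).trans (hs.moment_slice _))]
  rw [h1, h2]
  exact (hs.orbitHomeomorph hΦ).symm_apply_apply
    (OrbitSpace.proj act Φ ⟨θ t z.1, (hinv t z.1).trans z.2⟩)

end IsGlobalSlice

/-! ### The global slice `p ↦ (p, (1, μ(p)_{(m)})_m)` -/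

section ExtSlice

variable {k : ℕ}

/-- `minors` as a linear map. -/
noncomputable def minorsLin (k : ℕ) : Matrix (Fin (k + 1)) (Fin (k + 1)) ℂ →ₗ[ℂ] GlProd k :=
  LinearMap.pi fun m => upperLeftLin m.2

/-- The global slice of `extAct`. -/
noncomputable def extSlice {M : Type*} (μ : M → Matrix (Fin (k + 1)) (Fin (k + 1)) ℂ) (p : M) :
    ExtSpace k M :=
  (p, (1, minors (μ p)))

/-- The retraction to the slice. -/
noncomputable def extRetraction {M : Type*} [MulAction (GL (Fin (k + 1)) ℂ) M]
    (x : ExtSpace k M) : M :=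
  lastUnit (gaugeUnit x.2.1) • x.1

/-- The group element which takes the slice to a given point of the zero level set. -/
noncomputable def extGauge {M : Type*} (x : ExtSpace k M) : (GlProd k)ˣ :=
  (gaugeUnit x.2.1)⁻¹

theorem extMoment_extSlice {M : Type*} (μ : M → Matrix (Fin (k + 1)) (Fin (k + 1)) ℂ) (p : M) :
    extMoment μ (extSlice μ p) = 0 := by
  rw [extMoment_eq]
  simp only [extSlice, inv_one, Units.val_one, one_mul, mul_one]
  rw [← minors_eq, sub_self]

/-! ### The slice meets each orbit of the zero level exactly once, freely -/

section Algebra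

variable {M : Type*} [MulAction (GL (Fin (k + 1)) ℂ) M]

theorem extGauge_extAct (μ : M → Matrix (Fin (k + 1)) (Fin (k + 1)) ℂ) (h : (GlProd k)ˣ) (p : M) :
    extGauge (extAct h (extSlice μ p)) = h := by
  have h1 : h⁻¹ = gaugeUnit (leftPart h * 1 * h⁻¹) := by
    refine eq_gaugeUnit ?_
    rw [mul_one, leftPart_inv, inv_mul_cancel_left]
  rw [extGauge, extAct_eq]
  exact inv_eq_iff_eq_inv.2 h1.symm

theorem extRetraction_extAct (μ : M → Matrix (Fin (k + 1)) (Fin (k + 1)) ℂ) (h : (GlProd k)ˣ)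
    (p : M) : extRetraction (extAct h (extSlice μ p)) = p := by
  have h1 : gaugeUnit (extAct h (extSlice μ p)).2.1 = h⁻¹ :=
    inv_eq_iff_eq_inv.1 (extGauge_extAct μ h p)
  rw [extRetraction, h1, lastUnit_inv]
  exact inv_smul_smul (lastUnit h) p

/-- Moving `x` by `gaugeUnit` makes its group component `1`, and equivariance keeps it in the zero
level. There the vanishing of the moment map determines `B`. -/
theorem extAct_extSlice {μ : M → Matrix (Fin (k + 1)) (Fin (k + 1)) ℂ}
    (hμ : ∀ (g : GL (Fin (k + 1)) ℂ) (p : M), μ (g • p) = g * μ p * (g⁻¹ : GL (Fin (k + 1)) ℂ))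
    {x : ExtSpace k M} (hx : extMoment μ x = 0) :
    extAct (extGauge x) (extSlice μ (extRetraction x)) = x := by
  set y := extAct (gaugeUnit x.2.1) x with hy
  have h0 : extMoment μ y = 0 := by
    rw [hy, extMoment_extAct hμ, hx, mul_zero, zero_mul]
  have h1 : y.2.1 = 1 := by
    have := gaugeUnit_eq x.2.1
    rw [hy, extAct_eq]
    change leftPart _ * _ * _ = _
    rw [← this, mul_inv_cancel]
  rw [extMoment_eq, h1, inv_one, Units.val_one, one_mul, mul_one, sub_eq_zero] at h0
  have h2 : y = extSlice μ (extRetraction x) :=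
    Prod.ext rfl (Prod.ext h1 (eq_minors h0.symm))
  rw [← h2, hy, extGauge, ← mul_extAct, inv_mul_cancel, one_extAct]

end Algebra

/-! ### Holomorphy of the slice data, and the pull-back of the form -/

section Calculus

variable {E : Type*} [NormedAddCommGroup E] [NormedSpace ℂ E]
  {M : Type*} [TopologicalSpace M] [ChartedSpace E M]

theorem contMDiff_glProd_iff {H : Type*} [TopologicalSpace H] {I : ModelWithCorners ℂ E H}
    {X : Type*} [TopologicalSpace X] [ChartedSpace H X] {f : X → GlProd k} :
    ContMDiff I 𝓘(ℂ, GlProd k) ω f ↔ ∀ j : Fin (k + 1),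
      ContMDiff I 𝓘(ℂ, Matrix (Fin (j + 1)) (Fin (j + 1)) ℂ) ω (fun x => f x j) :=
  contMDiff_pi_space

/-- By the recursion, each component is a polynomial in the components of `g`. -/
theorem contMDiff_gaugeUnit : ContMDiff 𝓘(ℂ, GlProd k) 𝓘(ℂ, GlProd k) ω
    (gaugeUnit : (GlProd k)ˣ → (GlProd k)ˣ) := by
  refine Units.contMDiff_of_val (contMDiff_glProd_iff.2 fun j => ?_)
  have hg := contMDiff_glProd_iff.1 (Units.contMDiff_val (R := GlProd k) (𝕜 := ℂ) (n := ω))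
  induction j using Fin.induction with
  | zero => exact hg 0
  | succ i ih =>
    simp only [gaugeUnit_succ, cornerHom_eq]
    exact (((cornerLin (i + 1)).toContinuousLinearMap.contMDiff.comp ih).add
      contMDiff_const).mul_algebra (hg i.succ)

theorem contMDiff_minors {μ : M → Matrix (Fin (k + 1)) (Fin (k + 1)) ℂ}
    (hμ : ContMDiff 𝓘(ℂ, E) 𝓘(ℂ, Matrix (Fin (k + 1)) (Fin (k + 1)) ℂ) ω μ) :
    ContMDiff 𝓘(ℂ, E) 𝓘(ℂ, GlProd k) ω (fun p => minors (μ p)) :=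
  (minorsLin k).toContinuousLinearMap.contMDiff.comp hμ

theorem contMDiff_extSlice {μ : M → Matrix (Fin (k + 1)) (Fin (k + 1)) ℂ}
    (hμ : ContMDiff 𝓘(ℂ, E) 𝓘(ℂ, Matrix (Fin (k + 1)) (Fin (k + 1)) ℂ) ω μ) :
    ContMDiff 𝓘(ℂ, E) (extModel k E) ω (extSlice μ) :=
  contMDiff_id.prodMk (contMDiff_const.prodMk (contMDiff_minors hμ))

theorem hasMFDerivAt_extSlice {μ : M → Matrix (Fin (k + 1)) (Fin (k + 1)) ℂ}
    (hμ : ContMDiff 𝓘(ℂ, E) 𝓘(ℂ, Matrix (Fin (k + 1)) (Fin (k + 1)) ℂ) ω μ) (p : M) :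
    ∃ ν : E →L[ℂ] GlProd k, HasMFDerivAt 𝓘(ℂ, E) (extModel k E) (extSlice μ) p
      ((ContinuousLinearMap.id ℂ E).prod ((0 : E →L[ℂ] GlProd k).prod ν)) :=
  ⟨mfderiv 𝓘(ℂ, E) 𝓘(ℂ, GlProd k) (fun p => minors (μ p)) p,
    (hasMFDerivAt_id p).prodMk ((hasMFDerivAt_const 1 p).prodMk
      ((contMDiff_minors hμ).mdifferentiable (by simp) p).hasMFDerivAt)⟩

theorem cotangentBilin_vertical (g : (GlProd k)ˣ) (B a b : GlProd k) :
    cotangentBilin g B (0, a) (0, b) = 0 := by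
  rw [cotangentBilin_apply]
  simp [Ring.lie_def]

/-- The group component is constant along the slice, so the cotangent part is evaluated on two
vertical vectors, where it vanishes. -/
theorem extForm_extSlice (σ : TwoForm 𝓘(ℂ, E) M)
    {μ : M → Matrix (Fin (k + 1)) (Fin (k + 1)) ℂ}
    (hμ : ContMDiff 𝓘(ℂ, E) 𝓘(ℂ, Matrix (Fin (k + 1)) (Fin (k + 1)) ℂ) ω μ) (p : M)
    (v w : TangentSpace 𝓘(ℂ, E) p) :
    extForm k σ (extSlice μ p) (mfderiv 𝓘(ℂ, E) (extModel k E) (extSlice μ) p v)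
      (mfderiv 𝓘(ℂ, E) (extModel k E) (extSlice μ) p w) = σ p v w := by
  obtain ⟨ν, hν⟩ := hasMFDerivAt_extSlice hμ p
  rw [hν.mfderiv]
  refine (extForm_apply σ (extSlice μ p) (v, 0, ν v) (w, 0, ν w)).trans ?_
  exact (congrArg (σ p v w + ·) (cotangentBilin_vertical _ _ (ν v) (ν w))).trans
    (add_zero (σ p v w))

theorem isGlobalSlice_extSlice [MulAction (GL (Fin (k + 1)) ℂ) M] {σ : TwoForm 𝓘(ℂ, E) M}
    {μ : M → Matrix (Fin (k + 1)) (Fin (k + 1)) ℂ}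
    (hμ : IsHamiltonianAction (Matrix.traceLinearMap (Fin (k + 1)) ℂ ℂ) σ
      (fun (g : GL (Fin (k + 1)) ℂ) (p : M) => g • p) μ) :
    IsGlobalSlice (E := E) (extModel k E) extAct (extMoment μ) (extSlice μ) extRetraction
      extGauge where
  holomorphic_slice := contMDiff_extSlice hμ.holomorphic_moment
  holomorphic_retraction := hμ.holomorphic_act.comp
    ((contMDiff_lastUnit.comp (contMDiff_gaugeUnit.comp contMDiff_extSpace_group)).prodMk
      contMDiff_fst)
  holomorphic_gauge := (contMDiff_gaugeUnit.comp contMDiff_extSpace_group).inv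
  moment_slice := extMoment_extSlice μ
  act_slice _ := extAct_extSlice hμ.equivariant
  retraction_act := extRetraction_extAct μ
  gauge_act := extGauge_extAct μ

end Calculus

end ExtSlice

/-! ### The theorem, with `n = k + 1` -/

theorem mainTheorem8 (k : ℕ)
    {E : Type*} [NormedAddCommGroup E] [NormedSpace ℂ E] [FiniteDimensional ℂ E]
    {M : Type*} [TopologicalSpace M] [ChartedSpace E M] [IsManifold 𝓘(ℂ, E) ω M]
    [MulAction (GL (Fin (k + 1)) ℂ) M]
    (σ : TwoForm 𝓘(ℂ, E) M) (hσ : IsSymplecticForm σ)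
    (μ : M → Matrix (Fin (k + 1)) (Fin (k + 1)) ℂ)
    (hμ : IsHamiltonianAction (Matrix.traceLinearMap (Fin (k + 1)) ℂ ℂ) σ
      (fun (g : GL (Fin (k + 1)) ℂ) (p : M) => g • p) μ) :
    -- the extended space is a symplectic manifold with a Hamiltonian action of `∏ GL(i)`
    IsSymplecticForm (extForm k σ) ∧
    IsHamiltonianAction (trProd k) (extForm k σ) extAct (extMoment μ) ∧
    -- and with a commuting Hamiltonian action of `∏ C_m`
    IsHamiltonianVectorAction (extForm k σ) gzAct gzHam ∧
    (∀ (t : GZIndex k → ℂ) (h : (GlProd k)ˣ) (x : ExtSpace k M),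
      gzAct t (extAct h x) = extAct h (gzAct t x)) ∧
    -- the symplectic quotient by `∏ GL(i)` exists
    ∃ (_ : ChartedSpace (E × GlProd k) (ZeroLevel (extMoment (k := k) μ)))
      (_ : ChartedSpace E (OrbitSpace extAct (extMoment (k := k) μ)))
      (σQ : TwoForm 𝓘(ℂ, E) (OrbitSpace extAct (extMoment (k := k) μ))),
      IsSymplecticQuotient (EZ := E × GlProd k) (extForm k σ) extAct (extMoment μ) σQ ∧
      -- and is symplectomorphic to `M`
      ∃ Ψ : M ≃ₘ^ω⟮𝓘(ℂ, E), 𝓘(ℂ, E)⟯ OrbitSpace extAct (extMoment (k := k) μ),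
        (∀ (p : M) (v w : TangentSpace 𝓘(ℂ, E) p),
          σQ (Ψ p) (mfderiv 𝓘(ℂ, E) 𝓘(ℂ, E) Ψ p v) (mfderiv 𝓘(ℂ, E) 𝓘(ℂ, E) Ψ p w)
            = σ p v w) ∧
        -- where `p` corresponds to the class of `(p, (1, μ(p)_{(m)})_m)`
        (∀ p : M, ∃ z : ZeroLevel (extMoment (k := k) μ),
          z.1 = (p, (1, fun m : Fin (k + 1) => upperLeft m.2 (μ p))) ∧
          Ψ p = OrbitSpace.proj extAct (extMoment μ) z) ∧
        -- and the residual action of `∏ C_m` has the Hamiltonians `tr (μ(p)_{(m)})^i`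
        ∃ θ : (GZIndex k → ℂ) → M → M,
          (∀ (t : GZIndex k → ℂ) (z : ZeroLevel (extMoment (k := k) μ)),
            ∃ ht : extMoment μ (gzAct t z.1) = 0, ∀ p : M,
              Ψ p = OrbitSpace.proj extAct (extMoment μ) z →
              Ψ (θ t p) = OrbitSpace.proj extAct (extMoment μ) ⟨gzAct t z.1, ht⟩) ∧
          IsHamiltonianVectorAction σ θ
            (fun a p => (upperLeft a.1.2 (μ p) ^ ((a.2 : ℕ) + 1)).trace) := by
  have hX := isSymplecticForm_extForm (k := k) hσ
  have hΦ := isHamiltonianAction_extAct hμ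
  have hθ := isHamiltonianVectorAction_gzAct (k := k) σ
  have hs := isGlobalSlice_extSlice hμ
  have hσs := extForm_extSlice σ hμ.holomorphic_moment
  refine ⟨hX, hΦ, hθ, gzAct_extAct, hs.levelChartedSpace hΦ, hs.orbitChartedSpace hΦ,
    (hs.orbitHomeomorph hΦ).transportForm σ, ?_, hs.orbitDiffeomorph hΦ,
    hs.orbitDiffeomorph_symplectic hΦ σ, fun p => ⟨⟨extSlice μ p, hs.moment_slice p⟩, rfl, rfl⟩,
    fun t p => extRetraction (gzAct t (extSlice μ p)), fun t z => ?_, ?_⟩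
  · exact hs.isSymplecticQuotient hΦ hX.alternating
      (fun x _ => surjective_mfderiv_extMoment x
        (hμ.holomorphic_moment.mdifferentiable (by simp) x.1)) hσ hσs
  · refine ⟨(extMoment_gzAct μ t z.1).trans z.2, fun p hp => ?_⟩
    exact hs.proj_slice_vectorAction hΦ gzAct_extAct (extMoment_gzAct μ) t z hp
  · exact hs.isHamiltonianVectorAction_slice hΦ hX.alternating hσs hθ gzAct_extAct
      (extMoment_gzAct μ) gzHam_extAct
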